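/- **Setting.** All Hilbert spaces are complex. Let $d$ be a natural number and let $\Gamma$ be the full Fock space over $\mathbb C^d$, with orthonormal basis $(e_\alpha)$ indexed by the words $\alpha$ in $1,\dots,d$, vacuum vector $e_0=e_\emptyset$ and creation operators $L_i e_\alpha=e_i\otimes e_\alpha=e_{i\alpha}$. An operator $M:\Gamma\otimes\mathcal X\to\Gamma\otimes\mathcal Y$ is *multi-analytic* if $M(L_i\otimes I)=(L_i\otimes I)M$ for all $i$. It is a *purely contractive* multi-analytic operator if moreover $\|M\|\le 1$ and $\|P_{e_0\otimes\mathcal Y}M(e_0\otimes x)\|<\|x\|$ for all $0\ne x\in\mathcal X$. For an operator $T:\mathcal X\to\mathcal Y$ with $\|T\|\le 1$ put $D_T=(I-T^*T)^{1/2}$, $D_{*,T}=(I-TT^*)^{1/2}$, $\mathcal D_T=\overline{\operatorname{ran}}\,D_T\subseteq\mathcal X$ and $\mathcal D_{*,T}=\overline{\operatorname{ran}}\,D_{*,T}\subseteq\mathcal Y$. A *row contraction* on $\mathcal H$ is a tuple $\underline S=(S_1,\dots,S_d)$ of bounded operators on $\mathcal H$ with $\sum_i S_iS_i^*\le I$;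 it is identified with the contraction $\underline S:\mathcal H^d\to\mathcal H$, $(h_i)\mapsto\sum_i S_ih_i$, and $D_S,\ D_{*,S},\ \mathcal D_S\subseteq\mathcal H^d,\ \mathcal D_{*,S}\subseteq\mathcal H$ are formed from this contraction. For a word $\alpha=\alpha_1\cdots\alpha_n$ put $S_\alpha=S_{\alpha_1}\cdots S_{\alpha_n}$, and let $P_j:\mathcal H^d\to\mathcal H$ be the $j$-th coordinate map. The *characteristic function* of a row contraction $\underline A$ is the multi-analytic operator $M_A:\Gamma\otimes\mathcal D_A\to\Gamma\otimes\mathcal D_{*,A}$ with $$M_A(e_0\otimes x)=-e_0\otimes\underline A x+\sum_{j=1}^d\sum_\alpha e_j\otimes e_\alpha\otimes D_{*,A}A_\alpha^*P_jD_Ax ,\qquad x\in\mathcal D_A .$$ The *minimal isometric dilation* of $\underline S$ is the tuple $V^S_j(h\oplus f)=S_jh\oplus\big(e_0\otimes D_S(0,\dots,h,\dots,0)+(L_j\otimes I)f\big)$ ($h$ in the $j$-th place) on $\hat{\mathcal H}_S=\mathcal H\oplus(\Gamma\otimes\mathcal D_S)$. If a row contraction $\underline E$ on $\mathcal H_C\oplus\mathcal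 H_A$ with $E_i=\begin{bmatrix}C_i&0\\B_i&A_i\end{bmatrix}$ is a lifting of $\underline C$, there are a Hilbert space $\mathcal K$, operators $Y_i$ on $\mathcal K$ and a unitary $W:\hat{\mathcal H}_E\to\hat{\mathcal H}_C\oplus\mathcal K$ with $W|_{\mathcal H_C}=I_{\mathcal H_C}$ and $WV^E_i=(V^C_i\oplus Y_i)W$ for all $i$; the *characteristic function of the lifting* is $M_{C,E}=P_{\Gamma\otimes\mathcal D_C}W|_{\Gamma\otimes\mathcal D_E}:\Gamma\otimes\mathcal D_E\to\Gamma\otimes\mathcal D_C$, which does not depend on the choice of $(\mathcal K,Y,W)$. **Theorem.** Let $\mathcal H_C,\mathcal H_A,\mathcal H_{A'},\mathcal F,\mathcal F_*$ be Hilbert spaces and let $\underline C,\underline A,\underline A'$ be row contractions of length $d$ on $\mathcal H_C,\mathcal H_A,\mathcal H_{A'}$. Let $\lambda:\mathcal D_{*,A}\oplus\mathcal F_*\to\mathcal D_C$ be a contraction and $U:\mathcal F\oplus\mathcal D_{*,A'}\to\mathcal D_A\oplus\mathcal F_*$ a unitary. Put $$\underline{\hat A}=\begin{bmatrix}\underline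 A&0\\ \underline B&\underline A'\end{bmatrix},\qquad \underline B=D_{*,A'}\big(P_{\mathcal D_{*,A'}}U^*|_{\mathcal D_A}\big)D_A ,$$ $$\tilde{\mathcal M}=\begin{bmatrix}M_A&0\\0&I_{\Gamma\otimes\mathcal F_*}\end{bmatrix}(I_\Gamma\otimes U)\begin{bmatrix}I_{\Gamma\otimes\mathcal F}&0\\0&M_{A'}\end{bmatrix}:\Gamma\otimes(\mathcal F\oplus\mathcal D_{A'})\to\Gamma\otimes(\mathcal D_{*,A}\oplus\mathcal F_*),$$ and define $\mathcal M:\Gamma\otimes(\mathcal D_{*,\lambda}\oplus\mathcal F\oplus\mathcal D_{A'})\to\Gamma\otimes\mathcal D_C$ by $$\mathcal M=\begin{bmatrix}I_\Gamma\otimes D_{*,\lambda}&I_\Gamma\otimes\lambda\end{bmatrix}\begin{bmatrix}I&0&0\\0&M_A&0\\0&0&I_{\Gamma\otimes\mathcal F_*}\end{bmatrix}\begin{bmatrix}I&0\\0&I_\Gamma\otimes U\end{bmatrix}\begin{bmatrix}I&0&0\\0&I_{\Gamma\otimes\mathcal F}&0\\0&0&M_{A'}\end{bmatrix},\qquad I=I_{\Gamma\otimes\mathcal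 D_{*,\lambda}} .$$ If $\tilde{\mathcal M}$ is a purely contractive multi-analytic operator, then $\underline{\hat A}$ is a row contraction and there is a unitary $\phi:\mathcal D_{*,\hat A}\to\mathcal D_{*,A}\oplus\mathcal F_*$ such that $$\underline E'=\begin{bmatrix}\underline C&0\\ D_{*,\hat A}\phi^*\lambda^*D_C&\underline{\hat A}\end{bmatrix}$$ is a row contraction (hence a contractive lifting of $\underline C$) whose characteristic function $M_{C,E'}$ coincides with $\mathcal M$: there is a unitary $\tau:\mathcal D_{*,\lambda}\oplus\mathcal F\oplus\mathcal D_{A'}\to\mathcal D_{E'}$ with $M_{C,E'}(I_\Gamma\otimes\tau)=\mathcal M$. -/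

import Mathlib

open ContinuousLinearMap

noncomputable section

/-! ## Orthogonal sums of two Hilbert spaces -/

/-- The orthogonal direct sum `X ⊕ Y` of two Hilbert spaces. -/
abbrev HSum (X Y : Type*) : Type _ := WithLp 2 (X × Y)

/-! Mathlib's own instances, recorded again to speed up instance search. -/

section HSumInstances

variable {X Y : Type*} [NormedAddCommGroup X] [InnerProductSpace ℂ X]
  [NormedAddCommGroup Y] [InnerProductSpace ℂ Y]

instance : NormedAddCommGroup (HSum X Y) := inferInstance
instance : TopologicalSpace (HSum X Y) := inferInstance
instance : AddCommMonoid (HSum X Y) := inferInstance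
instance : SeminormedAddCommGroup (HSum X Y) := inferInstance
instance : NormedSpace ℂ (HSum X Y) := inferInstance
instance : InnerProductSpace ℂ (HSum X Y) := inferInstance
instance : Module ℂ (HSum X Y) := inferInstance
instance [CompleteSpace X] [CompleteSpace Y] : CompleteSpace (HSum X Y) := inferInstance

end HSumInstances

section HSum

variable {X Y X' Y' Z : Type*}
  [NormedAddCommGroup X] [InnerProductSpace ℂ X]
  [NormedAddCommGroup Y] [InnerProductSpace ℂ Y]
  [NormedAddCommGroup X'] [InnerProductSpace ℂ X']
  [NormedAddCommGroup Y'] [InnerProductSpace ℂ Y']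
  [NormedAddCommGroup Z] [InnerProductSpace ℂ Z]

/-- The inclusion `x ↦ x ⊕ 0`. -/
def hinl (X Y : Type*) [NormedAddCommGroup X] [InnerProductSpace ℂ X]
    [NormedAddCommGroup Y] [InnerProductSpace ℂ Y] : X →L[ℂ] HSum X Y :=
  (WithLp.prodContinuousLinearEquiv 2 ℂ X Y).symm.toContinuousLinearMap ∘L
    ContinuousLinearMap.inl ℂ X Y

/-- The inclusion `y ↦ 0 ⊕ y`. -/
def hinr (X Y : Type*) [NormedAddCommGroup X] [InnerProductSpace ℂ X]
    [NormedAddCommGroup Y] [InnerProductSpace ℂ Y] : Y →L[ℂ] HSum X Y :=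
  (WithLp.prodContinuousLinearEquiv 2 ℂ X Y).symm.toContinuousLinearMap ∘L
    ContinuousLinearMap.inr ℂ X Y

/-- The coordinate projection `x ⊕ y ↦ x`. -/
def hfst (X Y : Type*) [NormedAddCommGroup X] [InnerProductSpace ℂ X]
    [NormedAddCommGroup Y] [InnerProductSpace ℂ Y] : HSum X Y →L[ℂ] X :=
  WithLp.fstL 2 ℂ X Y

/-- The coordinate projection `x ⊕ y ↦ y`. -/
def hsnd (X Y : Type*) [NormedAddCommGroup X] [InnerProductSpace ℂ X]
    [NormedAddCommGroup Y] [InnerProductSpace ℂ Y] : HSum X Y →L[ℂ] Y :=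
  WithLp.sndL 2 ℂ X Y

/-- The row operator `[S  T] : X ⊕ Y → Z`. -/
def hrow (S : X →L[ℂ] Z) (T : Y →L[ℂ] Z) : HSum X Y →L[ℂ] Z :=
  S ∘L hfst X Y + T ∘L hsnd X Y

/-- The diagonal operator `diag(S, T) : X ⊕ Y → X' ⊕ Y'`. -/
def hdiag (S : X →L[ℂ] X') (T : Y →L[ℂ] Y') : HSum X Y →L[ℂ] HSum X' Y' :=
  hinl X' Y' ∘L S ∘L hfst X Y + hinr X' Y' ∘L T ∘L hsnd X Y

/-- The lower triangular operator `[[P, 0], [Q, R]]` on `X ⊕ Y`. -/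
def htri (P : X →L[ℂ] X) (Q : X →L[ℂ] Y) (R : Y →L[ℂ] Y) : HSum X Y →L[ℂ] HSum X Y :=
  hinl X Y ∘L P ∘L hfst X Y + hinr X Y ∘L Q ∘L hfst X Y + hinr X Y ∘L R ∘L hsnd X Y

theorem hdiag_nonneg {S : X →L[ℂ] X} {T : Y →L[ℂ] Y} (hS : 0 ≤ S) (hT : 0 ≤ T) :
    0 ≤ hdiag S T := by
  rw [ContinuousLinearMap.nonneg_iff_isPositive, ContinuousLinearMap.isPositive_iff_complex] at *
  intro x
  have h1 : inner ℂ (hdiag S T x) x = inner ℂ (S x.fst) x.fst + inner ℂ (T x.snd) x.snd := by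
    simp [hdiag, hinl, hinr, hfst, hsnd, WithLp.prod_inner_apply]
  rw [h1]
  obtain ⟨a, b⟩ := hS x.fst
  obtain ⟨c, d⟩ := hT x.snd
  refine ⟨?_, ?_⟩
  · rw [← a, ← c]; simp
  · simpa using add_nonneg b d

theorem hdiag_mul (S S' : X →L[ℂ] X) (T T' : Y →L[ℂ] Y) :
    hdiag S T * hdiag S' T' = hdiag (S * S') (T * T') := by
  ext x
  all_goals simp [hdiag, hinl, hinr, hfst, hsnd]

end HSum

/-! ## Defect operators and defect spaces of an operator -/

section Defect

variable {X Y : Type*}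
  [NormedAddCommGroup X] [InnerProductSpace ℂ X] [CompleteSpace X]
  [NormedAddCommGroup Y] [InnerProductSpace ℂ Y] [CompleteSpace Y]

/-- `D_T = (I - T* T)^{1/2}`. -/
def defect (T : X →L[ℂ] Y) : X →L[ℂ] X := CFC.sqrt (1 - adjoint T ∘L T)

/-- `D_{*,T} = (I - T T*)^{1/2}`. -/
def codefect (T : X →L[ℂ] Y) : Y →L[ℂ] Y := CFC.sqrt (1 - T ∘L adjoint T)

/-- `𝒟_T`, the closure of the range of `D_T`. -/
def defectSpace (T : X →L[ℂ] Y) : Submodule ℂ X :=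
  (LinearMap.range (defect T).toLinearMap).topologicalClosure

/-- `𝒟_{*,T}`, the closure of the range of `D_{*,T}`. -/
def codefectSpace (T : X →L[ℂ] Y) : Submodule ℂ Y :=
  (LinearMap.range (codefect T).toLinearMap).topologicalClosure

instance (T : X →L[ℂ] Y) : CompleteSpace (defectSpace T) :=
  (Submodule.isClosed_topologicalClosure _).completeSpace_coe

instance (T : X →L[ℂ] Y) : CompleteSpace (codefectSpace T) :=
  (Submodule.isClosed_topologicalClosure _).completeSpace_coe

/-- `D_{*,T}` restricted to `𝒟_{*,T}`. -/
def codefectOn (T : X →L[ℂ] Y) : codefectSpace T →L[ℂ] Y :=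
  codefect T ∘L (codefectSpace T).subtypeL

theorem defect_mem (T : X →L[ℂ] Y) (x : X) : defect T x ∈ defectSpace T :=
  Submodule.le_topologicalClosure _ ⟨x, rfl⟩

theorem codefect_mem (T : X →L[ℂ] Y) (y : Y) : codefect T y ∈ codefectSpace T :=
  Submodule.le_topologicalClosure _ ⟨y, rfl⟩

/-- `D_T` as a map into `𝒟_T`. -/
def toDefect (T : X →L[ℂ] Y) : X →L[ℂ] defectSpace T :=
  (defect T).codRestrict _ (defect_mem T)

/-- `D_{*,T}` as a map into `𝒟_{*,T}`. -/
def toCodefect (T : X →L[ℂ] Y) : Y →L[ℂ] codefectSpace T :=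
  (codefect T).codRestrict _ (codefect_mem T)

theorem one_sub_adjoint_comp_nonneg {T : X →L[ℂ] Y} (hT : ‖T‖ ≤ 1) :
    0 ≤ 1 - adjoint T ∘L T := by
  rw [ContinuousLinearMap.nonneg_iff_isPositive, ContinuousLinearMap.isPositive_iff_complex]
  intro x
  have h1 : inner ℂ ((1 - adjoint T ∘L T) x) x = ((‖x‖ ^ 2 - ‖T x‖ ^ 2 : ℝ) : ℂ) := by
    rw [sub_apply, inner_sub_left, ContinuousLinearMap.comp_apply,
      ContinuousLinearMap.adjoint_inner_left, one_apply_eq_self, inner_self_eq_norm_sq_to_K,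
      inner_self_eq_norm_sq_to_K]
    push_cast
    rfl
  have h2 : ‖T x‖ ≤ ‖x‖ := by simpa using T.le_of_opNorm_le hT x
  rw [h1]
  refine ⟨rfl, ?_⟩
  have := pow_le_pow_left₀ (norm_nonneg _) h2 2
  change 0 ≤ ‖x‖ ^ 2 - ‖T x‖ ^ 2
  linarith

theorem one_sub_comp_adjoint_nonneg {T : X →L[ℂ] Y} (hT : ‖T‖ ≤ 1) :
    0 ≤ 1 - T ∘L adjoint T := by
  have h := one_sub_adjoint_comp_nonneg (T := adjoint T) (by simpa using hT)
  simpa using h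

theorem defect_nonneg (T : X →L[ℂ] Y) : 0 ≤ defect T := CFC.sqrt_nonneg _

theorem codefect_nonneg (T : X →L[ℂ] Y) : 0 ≤ codefect T := CFC.sqrt_nonneg _

theorem defect_mul_self {T : X →L[ℂ] Y} (hT : ‖T‖ ≤ 1) :
    defect T * defect T = 1 - adjoint T ∘L T :=
  CFC.sqrt_mul_sqrt_self _ (one_sub_adjoint_comp_nonneg hT)

theorem codefect_mul_self {T : X →L[ℂ] Y} (hT : ‖T‖ ≤ 1) :
    codefect T * codefect T = 1 - T ∘L adjoint T :=
  CFC.sqrt_mul_sqrt_self _ (one_sub_comp_adjoint_nonneg hT)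

theorem commute_of_mul_self {P Q S : X →L[ℂ] X} (hQ : 0 ≤ Q) (hP : Q * Q = P)
    (h : Commute P S) : Commute Q S := by
  rw [← CFC.sqrt_unique hP hQ, CFC.sqrt]
  exact Commute.cfcₙ_nnreal h _

/-- `T D_T = D_{*,T} T` for a contraction `T`. -/
theorem comp_defect {T : X →L[ℂ] Y} (hT : ‖T‖ ≤ 1) : T ∘L defect T = codefect T ∘L T := by
  have hP : hdiag (defect T) (codefect T) * hdiag (defect T) (codefect T) =
      hdiag (1 - adjoint T ∘L T) (1 - T ∘L adjoint T) := by
    rw [hdiag_mul, defect_mul_self hT, codefect_mul_self hT]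
  have hc : Commute (hdiag (1 - adjoint T ∘L T) (1 - T ∘L adjoint T))
      (hinr X Y ∘L T ∘L hfst X Y) := by
    refine ContinuousLinearMap.ext fun x => ?_
    refine WithLp.ofLp_injective 2 (Prod.ext ?_ ?_) <;> simp [hdiag, hinl, hinr, hfst, hsnd]
  have hc' := commute_of_mul_self (hdiag_nonneg (defect_nonneg T) (codefect_nonneg T)) hP hc
  refine ContinuousLinearMap.ext fun x => ?_
  have := congrArg (fun S => (S (hinl X Y x)).snd) hc'.eq
  simpa [hdiag, hinl, hinr, hfst, hsnd] using this.symm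

theorem map_defectSpace {T : X →L[ℂ] Y} (hT : ‖T‖ ≤ 1) (x : defectSpace T) :
    T x ∈ codefectSpace T := by
  have h : Set.MapsTo T (Set.range (defect T)) (codefectSpace T : Set Y) := by
    rintro _ ⟨z, rfl⟩
    have := congrArg (fun S => S z) (comp_defect hT)
    simp only [ContinuousLinearMap.comp_apply] at this
    rw [this]
    exact codefect_mem T _
  have h2 := h.closure T.continuous
  have hcl : IsClosed (codefectSpace T : Set Y) := Submodule.isClosed_topologicalClosure _
  rw [hcl.closure_eq] at h2
  exact h2 x.2

/-- A contraction `T` maps `𝒟_T` into `𝒟_{*,T}`; this is the restricted map `𝒟_T → 𝒟_{*,T}`. -/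
def restrictDefect (T : X →L[ℂ] Y) (hT : ‖T‖ ≤ 1) : defectSpace T →L[ℂ] codefectSpace T :=
  (T ∘L (defectSpace T).subtypeL).codRestrict _ (map_defectSpace hT)

/-- The operator `[[T*, D_T], [D_{*,T}, -T]]` is isometric. -/
theorem julia_norm {T : X →L[ℂ] Y} (hT : ‖T‖ ≤ 1) (y : Y) (x : X) :
    ‖adjoint T y + defect T x‖ ^ 2 + ‖codefect T y - T x‖ ^ 2 = ‖y‖ ^ 2 + ‖x‖ ^ 2 := by
  have hD : adjoint (defect T) = defect T :=
    (IsSelfAdjoint.of_nonneg (defect_nonneg T)).adjoint_eq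
  have hD' : adjoint (codefect T) = codefect T :=
    (IsSelfAdjoint.of_nonneg (codefect_nonneg T)).adjoint_eq
  have e1 : ‖defect T x‖ ^ 2 = ‖x‖ ^ 2 - ‖T x‖ ^ 2 := by
    have := congrArg (fun S : X →L[ℂ] X => RCLike.re (inner ℂ (S x) x)) (defect_mul_self hT)
    simp only [mul_apply_eq_comp] at this
    rw [← ContinuousLinearMap.adjoint_inner_right, hD] at this
    simpa [inner_sub_left, ContinuousLinearMap.adjoint_inner_left, inner_self_eq_norm_sq_to_K,
      ← Complex.ofReal_pow] using this
  have e2 : ‖codefect T y‖ ^ 2 = ‖y‖ ^ 2 - ‖adjoint T y‖ ^ 2 := by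
    have := congrArg (fun S : Y →L[ℂ] Y => RCLike.re (inner ℂ (S y) y)) (codefect_mul_self hT)
    simp only [mul_apply_eq_comp] at this
    rw [← ContinuousLinearMap.adjoint_inner_right, hD'] at this
    have h3 : inner ℂ (T (adjoint T y)) y = inner ℂ (adjoint T y) (adjoint T y) := by
      rw [ContinuousLinearMap.adjoint_inner_right]
    simpa [inner_sub_left, h3, inner_self_eq_norm_sq_to_K, ← Complex.ofReal_pow] using this
  have e3 : inner ℂ (adjoint T y) (defect T x) = inner ℂ (codefect T y) (T x) := by
    have := congrArg (fun S => S x) (comp_defect hT)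
    simp only [ContinuousLinearMap.comp_apply] at this
    rw [ContinuousLinearMap.adjoint_inner_left, this, ← ContinuousLinearMap.adjoint_inner_left, hD']
  rw [@norm_add_sq ℂ, @norm_sub_sq ℂ, e1, e2, e3]
  ring

end Defect

/-! ## Row contractions -/

section Row

variable {d : ℕ} {H K : Type*}
  [NormedAddCommGroup H] [InnerProductSpace ℂ H] [CompleteSpace H]
  [NormedAddCommGroup K] [InnerProductSpace ℂ K] [CompleteSpace K]

/-- `H^d`, the orthogonal sum of `d` copies of `H`. -/
abbrev Copies (d : ℕ) (H : Type*) : Type _ := PiLp 2 (fun _ : Fin d => H)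

instance : NormedAddCommGroup (Copies d H) := inferInstance
instance : InnerProductSpace ℂ (Copies d H) := inferInstance
instance : CompleteSpace (Copies d H) := inferInstance

/-- The inclusion `h ↦ (0, …, h, …, 0)` of `H` as the `i`-th summand of `H^d`. -/
def slot (H : Type*) [NormedAddCommGroup H] [InnerProductSpace ℂ H] {d : ℕ} (i : Fin d) :
    H →L[ℂ] Copies d H :=
  (PiLp.continuousLinearEquiv 2 ℂ (fun _ : Fin d => H)).symm.toContinuousLinearMap ∘L
    ContinuousLinearMap.single ℂ (fun _ : Fin d => H) i

/-- The row operator `(h_1, …, h_d) ↦ ∑ S_i h_i` of a tuple `S = (S_1, …, S_d)`. -/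
def rowOp (S : Fin d → H →L[ℂ] K) : Copies d H →L[ℂ] K :=
  ∑ i, S i ∘L PiLp.proj 2 (fun _ : Fin d => H) i

/-- `S = (S_1, …, S_d)` is a row contraction: `∑ S_i S_i* ≤ I`. -/
def IsRowContraction (S : Fin d → H →L[ℂ] H) : Prop :=
  ∑ i, S i ∘L adjoint (S i) ≤ 1

theorem adjoint_rowOp_apply (S : Fin d → H →L[ℂ] K) (k : K) (i : Fin d) :
    (adjoint (rowOp S) k) i = adjoint (S i) k := by
  refine ext_inner_right ℂ fun h => ?_
  have h1 : inner ℂ (adjoint (rowOp S) k) (slot H i h) = inner ℂ ((adjoint (rowOp S) k) i) h := by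
    rw [PiLp.inner_apply, Finset.sum_eq_single i]
    · simp [slot]
    · intro j _ hj; simp [slot, hj]
    · simp
  rw [← h1, ContinuousLinearMap.adjoint_inner_left, ContinuousLinearMap.adjoint_inner_left]
  congr 1
  rw [rowOp, sum_apply, Finset.sum_eq_single i]
  · simp [slot]
  · intro j _ hj; simp [slot, hj]
  · simp

theorem IsRowContraction.norm_rowOp_le {S : Fin d → H →L[ℂ] H} (hS : IsRowContraction S) :
    ‖rowOp S‖ ≤ 1 := by
  rw [← LinearIsometryEquiv.norm_map adjoint (rowOp S)]
  refine ContinuousLinearMap.opNorm_le_bound _ zero_le_one fun h => ?_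
  have h1 : ‖adjoint (rowOp S) h‖ ^ 2 = ∑ i, ‖adjoint (S i) h‖ ^ 2 := by
    rw [PiLp.norm_sq_eq_of_L2]
    simp [adjoint_rowOp_apply]
  have h2 := ((ContinuousLinearMap.isPositive_iff_complex _).1
    ((ContinuousLinearMap.le_def _ _).1 hS) h).2
  have h3 : ∑ i, ‖adjoint (S i) h‖ ^ 2 ≤ ‖h‖ ^ 2 := by
    have h4 : ∀ i, (inner ℂ (S i (adjoint (S i) h)) h).re = ‖adjoint (S i) h‖ ^ 2 := by
      intro i
      rw [← ContinuousLinearMap.adjoint_inner_right, inner_self_eq_norm_sq_to_K]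
      simp [← Complex.ofReal_pow]
    simpa [inner_sub_left, sum_inner, h4, inner_self_eq_norm_sq_to_K, ← Complex.ofReal_pow]
      using h2
  rw [one_mul]
  exact le_of_sq_le_sq (by linarith) (norm_nonneg _)

/-- `S_α = S_{α_1} ⋯ S_{α_n}` for a word `α = (α_1, …, α_n)`; the empty word gives `I`. -/
def wordOp (S : Fin d → H →L[ℂ] H) (α : List (Fin d)) : H →L[ℂ] H := (α.map S).prod

end Row

/-! ## Fock spaces -/

/-- `Γ ⊗ X` for the full Fock space `Γ = Γ(ℂ^d)`.  The vectors `e_α`, `α` a word in `1, …, d`, form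
an orthonormal basis of `Γ`, and `∑ e_α ⊗ x_α` is written as the square summable family
`α ↦ x_α`. -/
abbrev Fock (d : ℕ) (X : Type*) [NormedAddCommGroup X] : Type _ :=
  lp (fun _ : List (Fin d) => X) 2

/-! Mathlib's own instances, recorded again to speed up instance search. -/

section FockInstances

variable {d : ℕ} {X : Type*} [NormedAddCommGroup X] [InnerProductSpace ℂ X]

instance : NormedAddCommGroup (Fock d X) := inferInstance
instance : TopologicalSpace (Fock d X) := inferInstance
instance : AddCommMonoid (Fock d X) := inferInstance
instance : SeminormedAddCommGroup (Fock d X) := inferInstance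
instance : NormedSpace ℂ (Fock d X) := inferInstance
instance : InnerProductSpace ℂ (Fock d X) := inferInstance
instance : Module ℂ (Fock d X) := inferInstance

end FockInstances

section Fock

variable {d : ℕ} {X Y X' Y' : Type*}
  [NormedAddCommGroup X] [InnerProductSpace ℂ X]
  [NormedAddCommGroup Y] [InnerProductSpace ℂ Y]
  [NormedAddCommGroup X'] [InnerProductSpace ℂ X']
  [NormedAddCommGroup Y'] [InnerProductSpace ℂ Y']

/-- A linear map on families of vectors that is contractive in the `ℓ²` norm, as an operator between
Fock spaces. -/
def fockOp (Φ : (List (Fin d) → X) →ₗ[ℂ] (List (Fin d) → Y))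
    (hΦ : ∀ (f : Fock d X) (s : Finset (List (Fin d))), ∑ β ∈ s, ‖Φ f β‖ ^ 2 ≤ ‖f‖ ^ 2) :
    Fock d X →L[ℂ] Fock d Y :=
  LinearMap.mkContinuous
    { toFun := fun f => ⟨Φ f, memℓp_gen' (C := ‖f‖ ^ 2) fun s => by simpa using hΦ f s⟩
      map_add' := fun f g => by ext β; exact congrFun (map_add Φ (f : List (Fin d) → X) (g : List (Fin d) → X)) β
      map_smul' := fun c f => by ext β; exact congrFun (map_smul Φ c (f : List (Fin d) → X)) β }
    1
    fun f => by
      rw [one_mul]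
      refine lp.norm_le_of_forall_sum_le (by simp) (norm_nonneg _) fun s => ?_
      simpa using hΦ f s

/-- All words of length at most `n`. -/
def wordsLE (d : ℕ) : ℕ → Finset (List (Fin d))
  | 0 => {[]}
  | n + 1 => insert [] (Finset.univ.biUnion fun k : Fin d => (wordsLE d n).image (List.cons k))

theorem mem_wordsLE {n : ℕ} {β : List (Fin d)} (h : β.length ≤ n) : β ∈ wordsLE d n := by
  induction n generalizing β with
  | zero => simpa [wordsLE] using h
  | succ n ih =>
    cases β with
    | nil => simp [wordsLE]
    | cons k β => simpa [wordsLE] using ih (by simpa using h)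

theorem sum_wordsLE_succ (n : ℕ) (g : List (Fin d) → ℝ) :
    ∑ β ∈ wordsLE d (n + 1), g β = g [] + ∑ k, ∑ β ∈ wordsLE d n, g (k :: β) := by
  rw [wordsLE, Finset.sum_insert (by simp), Finset.sum_biUnion]
  · congr 1
    refine Finset.sum_congr rfl fun k _ => ?_
    rw [Finset.sum_image]
    intro a _ b _ h
    simpa using h
  · intro j _ k _ hjk
    rw [Function.onFun, Finset.disjoint_left]
    intro β hβ hβ'
    simp only [Finset.mem_image] at hβ hβ'
    obtain ⟨a, _, rfl⟩ := hβ
    obtain ⟨b, _, hb⟩ := hβ'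
    exact hjk (by simpa using (List.cons.inj hb).1.symm)

/-- To bound all finite partial sums it is enough to bound the sums over words of bounded length. -/
theorem sum_le_of_wordsLE {g : List (Fin d) → ℝ} (hg : ∀ β, 0 ≤ g β) {c : ℝ}
    (h : ∀ n, ∑ β ∈ wordsLE d n, g β ≤ c) (s : Finset (List (Fin d))) : ∑ β ∈ s, g β ≤ c := by
  refine le_trans (Finset.sum_le_sum_of_subset_of_nonneg (t := wordsLE d (s.sup List.length))
    ?_ fun β _ _ => hg β) (h (s.sup List.length))
  exact fun β hβ => mem_wordsLE (Finset.le_sup (f := List.length) hβ)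

theorem Fock.sum_le_norm_sq (f : Fock d X) (s : Finset (List (Fin d))) :
    ∑ β ∈ s, ‖f β‖ ^ 2 ≤ ‖f‖ ^ 2 := by
  simpa using lp.sum_rpow_le_norm_rpow (p := 2) (by simp) f s

/-- `e_∅ ⊗ x`, where `e_∅ = e_0` is the vacuum vector. -/
def vac (d : ℕ) (X : Type*) [NormedAddCommGroup X] [InnerProductSpace ℂ X] : X →L[ℂ] Fock d X :=
  lp.singleContinuousLinearMap ℂ (fun _ : List (Fin d) => X) 2 []

/-- The action of `L_j ⊗ I` on families: the entry at `α` is moved to `jα`, all other entries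
are `0`. -/
def creationFun (X : Type*) [NormedAddCommGroup X] [InnerProductSpace ℂ X] (j : Fin d) :
    (List (Fin d) → X) →ₗ[ℂ] (List (Fin d) → X) where
  toFun f
    | [] => 0
    | i :: α => if i = j then f α else 0
  map_add' f g := by
    funext β
    cases β with
    | nil => simp
    | cons i α => by_cases h : i = j <;> simp [h]
  map_smul' c f := by
    funext β
    cases β with
    | nil => simp
    | cons i α => by_cases h : i = j <;> simp [h]

theorem creationFun_sum_le (j : Fin d) (f : Fock d X) (s : Finset (List (Fin d))) :
    ∑ β ∈ s, ‖creationFun X j f β‖ ^ 2 ≤ ‖f‖ ^ 2 := by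
  refine sum_le_of_wordsLE (fun β => by positivity) (fun n => ?_) s
  cases n with
  | zero => simp [wordsLE, creationFun]
  | succ n =>
    rw [sum_wordsLE_succ, Finset.sum_eq_single j]
    · simpa [creationFun] using Fock.sum_le_norm_sq f (wordsLE d n)
    · intro k _ hk
      simp [creationFun, hk]
    · simp

/-- The creation operator `L_j ⊗ I` on `Γ ⊗ X`. -/
def creation (X : Type*) [NormedAddCommGroup X] [InnerProductSpace ℂ X] (j : Fin d) :
    Fock d X →L[ℂ] Fock d X :=
  fockOp (creationFun X j) (creationFun_sum_le j)

/-- The ampliation `I_Γ ⊗ T : Γ ⊗ X → Γ ⊗ Y`, that is `∑ e_α ⊗ x_α ↦ ∑ e_α ⊗ T x_α`. -/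
def ampl (d : ℕ) (T : X →L[ℂ] Y) : Fock d X →L[ℂ] Fock d Y :=
  lp.mapCLM 2 (fun _ : List (Fin d) => T) (norm_nonneg T) (fun _ => le_rfl)

/-- `diag(M, N)` as an operator `Γ ⊗ (X ⊕ Y) → Γ ⊗ (X' ⊕ Y')`, under the identification
`Γ ⊗ (X ⊕ Y) = (Γ ⊗ X) ⊕ (Γ ⊗ Y)`. -/
def fockDiag (M : Fock d X →L[ℂ] Fock d X') (N : Fock d Y →L[ℂ] Fock d Y') :
    Fock d (HSum X Y) →L[ℂ] Fock d (HSum X' Y') :=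
  ampl d (hinl X' Y') ∘L M ∘L ampl d (hfst X Y) + ampl d (hinr X' Y') ∘L N ∘L ampl d (hsnd X Y)

/-- `M` is multi-analytic: `M (L_i ⊗ I) = (L_i ⊗ I) M` for all `i`. -/
def IsMultiAnalytic (M : Fock d X →L[ℂ] Fock d Y) : Prop :=
  ∀ i : Fin d, M ∘L creation X i = creation Y i ∘L M

/-- A purely contractive multi-analytic operator: a multi-analytic contraction `M` with
`‖P_{e_∅ ⊗ Y} M (e_∅ ⊗ x)‖ < ‖x‖` for all `x ≠ 0`. -/
def IsPurelyContractive (M : Fock d X →L[ℂ] Fock d Y) : Prop :=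
  IsMultiAnalytic M ∧ ‖M‖ ≤ 1 ∧ ∀ x : X, x ≠ 0 → ‖M (vac d X x) []‖ < ‖x‖

/-- The action on families of the multi-analytic operator with symbol `x ↦ ∑ e_γ ⊗ θ_γ x`, that is
`e_α ⊗ x ↦ ∑ e_α ⊗ e_γ ⊗ θ_γ x`: the entry at `β` of the image of `∑ e_α ⊗ x_α` is the sum of
`θ_γ x_α` over all factorizations `β = αγ`. -/
def symbolFun (θ : List (Fin d) → X →L[ℂ] Y) :
    (List (Fin d) → X) →ₗ[ℂ] (List (Fin d) → Y) where
  toFun f β := ∑ n ∈ Finset.range (β.length + 1), θ (β.drop n) (f (β.take n))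
  map_add' f g := by funext β; simp [Finset.sum_add_distrib]
  map_smul' c f := by funext β; simp [Finset.smul_sum]

theorem symbolFun_nil (θ : List (Fin d) → X →L[ℂ] Y) (f : List (Fin d) → X) :
    symbolFun θ f [] = θ [] (f []) := by
  simp [symbolFun]

theorem symbolFun_cons (θ : List (Fin d) → X →L[ℂ] Y) (f : List (Fin d) → X) (k : Fin d)
    (β : List (Fin d)) :
    symbolFun θ f (k :: β) = θ (k :: β) (f []) + symbolFun θ (fun α => f (k :: α)) β := by
  simp only [symbolFun, LinearMap.coe_mk, AddHom.coe_mk, List.length_cons]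
  rw [Finset.sum_range_succ']
  simp [add_comm]

end Fock

/-! ## The characteristic function of a row contraction -/

section CharFn

variable {d : ℕ} {H : Type*} [NormedAddCommGroup H] [InnerProductSpace ℂ H] [CompleteSpace H]

/-- The coefficients of the symbol `θ_A : 𝒟_A → Γ ⊗ 𝒟_{*,A}`,
`θ_A x = - e_∅ ⊗ A x + ∑_j ∑_α e_j ⊗ e_α ⊗ D_{*,A} A_α* P_j D_A x`. -/
def charCoeff (A : Fin d → H →L[ℂ] H) (hA : IsRowContraction A) :
    List (Fin d) → defectSpace (rowOp A) →L[ℂ] codefectSpace (rowOp A)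
  | [] => -restrictDefect (rowOp A) hA.norm_rowOp_le
  | j :: α => toCodefect (rowOp A) ∘L adjoint (wordOp A α) ∘L
      PiLp.proj 2 (fun _ : Fin d => H) j ∘L defect (rowOp A) ∘L (defectSpace (rowOp A)).subtypeL

/-- A state-space form of the characteristic function, with initial state `x`. -/
theorem charCoeff_sum_le (A : Fin d → H →L[ℂ] H) (hA : IsRowContraction A) (n : ℕ) :
    ∀ (x : H) (f : List (Fin d) → defectSpace (rowOp A)),
    ∑ β ∈ wordsLE d n,
      ‖toCodefect (rowOp A) (adjoint (wordOp A β) x) + symbolFun (charCoeff A hA) f β‖ ^ 2 ≤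
      ‖x‖ ^ 2 + ∑ β ∈ wordsLE d n, ‖f β‖ ^ 2 := by
  have hone : ∀ x : H, adjoint (1 : H →L[ℂ] H) x = x := fun x => by
    rw [← ContinuousLinearMap.star_eq_adjoint, star_one, one_apply_eq_self]
  have hnil : ∀ (x : H) (f : List (Fin d) → defectSpace (rowOp A)),
      ‖toCodefect (rowOp A) (adjoint (wordOp A []) x) + symbolFun (charCoeff A hA) f []‖ ^ 2 =
      ‖codefect (rowOp A) x - rowOp A (f [])‖ ^ 2 := by
    intro x f
    rw [symbolFun_nil, Submodule.coe_norm]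
    simp [wordOp, charCoeff, toCodefect, sub_eq_add_neg, hone]
    rfl
  intro x f
  induction n generalizing x f with
  | zero =>
    have hj := julia_norm hA.norm_rowOp_le x (f [] : Copies d H)
    have := sq_nonneg ‖adjoint (rowOp A) x + defect (rowOp A) (f [])‖
    simp only [wordsLE, Finset.sum_singleton]
    rw [hnil, Submodule.coe_norm]
    linarith
  | succ n ih =>
    rw [sum_wordsLE_succ, sum_wordsLE_succ, hnil]
    have hj := julia_norm hA.norm_rowOp_le x (f [] : Copies d H)
    have hstep : ∀ k, ∑ β ∈ wordsLE d n,
        ‖toCodefect (rowOp A) (adjoint (wordOp A (k :: β)) x)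
          + symbolFun (charCoeff A hA) f (k :: β)‖ ^ 2 ≤
        ‖(adjoint (rowOp A) x + defect (rowOp A) (f [])) k‖ ^ 2
          + ∑ β ∈ wordsLE d n, ‖f (k :: β)‖ ^ 2 := by
      intro k
      refine le_trans (le_of_eq ?_)
        (ih ((adjoint (rowOp A) x + defect (rowOp A) (f [])) k) (fun β => f (k :: β)))
      refine Finset.sum_congr rfl fun β _ => ?_
      rw [symbolFun_cons, ← add_assoc]
      congr 3
      have : adjoint (wordOp A (k :: β)) x = adjoint (wordOp A β) (adjoint (A k) x) := by
        simp only [wordOp, List.map_cons, List.prod_cons]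
        rw [← ContinuousLinearMap.star_eq_adjoint, star_mul]
        rfl
      rw [this, PiLp.add_apply, adjoint_rowOp_apply, map_add, map_add]
      rfl
    have hsum := Finset.sum_le_sum fun k (_ : k ∈ Finset.univ) => hstep k
    rw [Finset.sum_add_distrib, ← PiLp.norm_sq_eq_of_L2] at hsum
    have := Submodule.coe_norm (f [])
    rw [← this] at hj
    linarith

theorem charFn_sum_le (A : Fin d → H →L[ℂ] H) (hA : IsRowContraction A)
    (f : Fock d (defectSpace (rowOp A))) (s : Finset (List (Fin d))) :
    ∑ β ∈ s, ‖symbolFun (charCoeff A hA) f β‖ ^ 2 ≤ ‖f‖ ^ 2 := by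
  refine sum_le_of_wordsLE (fun β => by positivity) (fun n => ?_) s
  have h1 := charCoeff_sum_le A hA n 0 f
  have h2 := Fock.sum_le_norm_sq f (wordsLE d n)
  simp only [map_zero, zero_add, norm_zero, ne_eq, OfNat.ofNat_ne_zero, not_false_eq_true,
    zero_pow] at h1
  exact h1.trans h2

/-- The characteristic function `M_A : Γ ⊗ 𝒟_A → Γ ⊗ 𝒟_{*,A}` of a row contraction `A`: the
multi-analytic operator with symbol `θ_A`. -/
def charFn (A : Fin d → H →L[ℂ] H) (hA : IsRowContraction A) :
    Fock d (defectSpace (rowOp A)) →L[ℂ] Fock d (codefectSpace (rowOp A)) :=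
  fockOp (symbolFun (charCoeff A hA)) (charFn_sum_le A hA)

end CharFn

/-! ## Liftings and their characteristic functions -/

section Lifting

variable {d : ℕ} {H : Type*} [NormedAddCommGroup H] [InnerProductSpace ℂ H] [CompleteSpace H]
  {HC HA : Type*} [NormedAddCommGroup HC] [InnerProductSpace ℂ HC] [CompleteSpace HC]
  [NormedAddCommGroup HA] [InnerProductSpace ℂ HA] [CompleteSpace HA]

/-- The tuple `E = [[C, 0], [B, A]]` on `H_C ⊕ H_A`, that is `E_i = [[C_i, 0], [B_i, A_i]]`, where
the row operator `B : H_C^d → H_A` has the entries `B_i`. -/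
def lifting (C : Fin d → HC →L[ℂ] HC) (B : Copies d HC →L[ℂ] HA) (A : Fin d → HA →L[ℂ] HA) :
    Fin d → HSum HC HA →L[ℂ] HSum HC HA :=
  fun i => htri (C i) (B ∘L slot HC i) (A i)

/-- The space `H ⊕ (Γ ⊗ 𝒟_S)` of the minimal isometric dilation of `S`. -/
abbrev DilSpace (S : Fin d → H →L[ℂ] H) : Type _ := HSum H (Fock d (defectSpace (rowOp S)))

/-- The minimal isometric dilation `V^S` of the row contraction `S`:
`V_j (h ⊕ f) = S_j h ⊕ (e_∅ ⊗ (D_S)_j h + (L_j ⊗ I) f)`. -/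
def dilation (S : Fin d → H →L[ℂ] H) (j : Fin d) : DilSpace S →L[ℂ] DilSpace S :=
  htri (S j) (vac d _ ∘L toDefect (rowOp S) ∘L slot H j) (creation _ j)

/-- `M : Γ ⊗ 𝒟_E → Γ ⊗ 𝒟_C` is the characteristic function of the lifting `E` of `C` (where `E` acts
on `H_C ⊕ H_A`): there are a Hilbert space `𝒦` (a subspace of the dilation space of `E`), operators
`Y_i` on it, and a unitary `W` from the dilation space of `E` onto the sum of the dilation space of
`C` and `𝒦` such that `W` is the identity on `H_C`, `W V^E_i = (V^C ⊕ Y)_i W` for all `i`, and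
`M = P_{Γ ⊗ 𝒟_C} W |_{Γ ⊗ 𝒟_E}`.  These conditions determine `M`. -/
def IsLiftingCharFn (C : Fin d → HC →L[ℂ] HC) (E : Fin d → HSum HC HA →L[ℂ] HSum HC HA)
    (M : Fock d (defectSpace (rowOp E)) →L[ℂ] Fock d (defectSpace (rowOp C))) : Prop :=
  ∃ (𝒦 : Submodule ℂ (DilSpace E)) (Y : Fin d → 𝒦 →L[ℂ] 𝒦)
    (W : DilSpace E ≃ₗᵢ[ℂ] HSum (DilSpace C) 𝒦),
    (∀ h : HC, W (hinl _ _ (hinl _ _ h)) = hinl _ _ (hinl _ _ h)) ∧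
    (∀ (i : Fin d) (x : DilSpace E),
      W (dilation E i x) = hdiag (dilation C i) (Y i) (W x)) ∧
    ∀ f : Fock d (defectSpace (rowOp E)), M f = (W (hinr _ _ f)).fst.snd

end Lifting

/-! ## The block operators of the theorem -/

section Blocks

variable {d : ℕ} {X Y X' Y' F Fs G Z : Type*}
  [NormedAddCommGroup X] [InnerProductSpace ℂ X]
  [NormedAddCommGroup Y] [InnerProductSpace ℂ Y]
  [NormedAddCommGroup X'] [InnerProductSpace ℂ X']
  [NormedAddCommGroup Y'] [InnerProductSpace ℂ Y']
  [NormedAddCommGroup F] [InnerProductSpace ℂ F]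
  [NormedAddCommGroup Fs] [InnerProductSpace ℂ Fs]
  [NormedAddCommGroup G] [InnerProductSpace ℂ G]
  [NormedAddCommGroup Z] [InnerProductSpace ℂ Z]

/-- `diag(M, I) (I ⊗ U) diag(I, M')` as an operator `Γ ⊗ (F ⊕ X') → Γ ⊗ (Y ⊕ F_*)`, for
`M : Γ ⊗ X → Γ ⊗ Y`, `M' : Γ ⊗ X' → Γ ⊗ Y'` and `U : F ⊕ Y' → X ⊕ F_*`. -/
def twoBlockProduct (M : Fock d X →L[ℂ] Fock d Y) (M' : Fock d X' →L[ℂ] Fock d Y')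
    (U : HSum F Y' ≃ₗᵢ[ℂ] HSum X Fs) : Fock d (HSum F X') →L[ℂ] Fock d (HSum Y Fs) :=
  fockDiag M (ContinuousLinearMap.id ℂ (Fock d Fs)) ∘L
    ampl d U.toContinuousLinearEquiv.toContinuousLinearMap ∘L
      fockDiag (ContinuousLinearMap.id ℂ (Fock d F)) M'

/-- `[I ⊗ D  I ⊗ λ] diag(I, M, I) diag(I, I ⊗ U) diag(I, I, M')` as an operator
`Γ ⊗ (Z ⊕ (F ⊕ X')) → Γ ⊗ G`, for `D : Z → G` and `λ : Y ⊕ F_* → G`; the first identity in each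
diagonal factor is that of `Γ ⊗ Z`. -/
def threeBlockProduct (D : Z →L[ℂ] G) (lam : HSum Y Fs →L[ℂ] G)
    (M : Fock d X →L[ℂ] Fock d Y) (M' : Fock d X' →L[ℂ] Fock d Y')
    (U : HSum F Y' ≃ₗᵢ[ℂ] HSum X Fs) : Fock d (HSum Z (HSum F X')) →L[ℂ] Fock d G :=
  ampl d (hrow D lam) ∘L
    fockDiag (ContinuousLinearMap.id ℂ (Fock d Z))
      (fockDiag M (ContinuousLinearMap.id ℂ (Fock d Fs))) ∘L
    fockDiag (ContinuousLinearMap.id ℂ (Fock d Z))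
      (ampl d U.toContinuousLinearEquiv.toContinuousLinearMap) ∘L
    fockDiag (ContinuousLinearMap.id ℂ (Fock d Z))
      (fockDiag (ContinuousLinearMap.id ℂ (Fock d F)) M')

end Blocks

/-! ## The liftings of the theorem -/

section Data

variable {d : ℕ} {HC HA HA' F Fs G : Type*}
  [NormedAddCommGroup HC] [InnerProductSpace ℂ HC] [CompleteSpace HC]
  [NormedAddCommGroup HA] [InnerProductSpace ℂ HA] [CompleteSpace HA]
  [NormedAddCommGroup HA'] [InnerProductSpace ℂ HA'] [CompleteSpace HA']
  [NormedAddCommGroup F] [InnerProductSpace ℂ F]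
  [NormedAddCommGroup Fs] [InnerProductSpace ℂ Fs]
  [NormedAddCommGroup G] [InnerProductSpace ℂ G] [CompleteSpace G]

/-- The compression `P_{Y'} U* |_X : X → Y'` of the adjoint of a unitary `U : F ⊕ Y' → X ⊕ F_*`. -/
def adjointCorner {X Y' : Type*} [NormedAddCommGroup X] [InnerProductSpace ℂ X]
    [NormedAddCommGroup Y'] [InnerProductSpace ℂ Y']
    (U : HSum F Y' ≃ₗᵢ[ℂ] HSum X Fs) : X →L[ℂ] Y' :=
  hsnd F Y' ∘L U.symm.toContinuousLinearEquiv.toContinuousLinearMap ∘L hinl X Fs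

/-- `Â = [[A, 0], [B, A']]` with `B = D_{*,A'} (P_{𝒟_{*,A'}} U* |_{𝒟_A}) D_A`. -/
def hatA (A : Fin d → HA →L[ℂ] HA) (A' : Fin d → HA' →L[ℂ] HA')
    (U : HSum F (codefectSpace (rowOp A')) ≃ₗᵢ[ℂ] HSum (defectSpace (rowOp A)) Fs) :
    Fin d → HSum HA HA' →L[ℂ] HSum HA HA' :=
  lifting A
    (codefectOn (rowOp A') ∘L adjointCorner U ∘L
      toDefect (rowOp A))
    A'

/-- `E' = [[C, 0], [D_{*,T} φ* λ* D_C, T]]` for a contraction `λ : G → 𝒟_C` and a unitary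
`φ : 𝒟_{*,T} → G`. -/
def liftE' (C : Fin d → HC →L[ℂ] HC) (T : Fin d → HA →L[ℂ] HA)
    (lam : G →L[ℂ] defectSpace (rowOp C)) (φ : codefectSpace (rowOp T) ≃ₗᵢ[ℂ] G) :
    Fin d → HSum HC HA →L[ℂ] HSum HC HA :=
  lifting C
    (codefectOn (rowOp T) ∘L
      φ.symm.toContinuousLinearEquiv.toContinuousLinearMap ∘L adjoint lam ∘L toDefect (rowOp C))
    T

end Data

end

/-!
The theorem is proved with unitary colligations: unitaries `𝒱 : S ⊕ X → S^d ⊕ Y` that send a state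
and an input to one new state for each letter and an output (`Colligation`). Running such a system
along words (`output`) defines a multi-analytic operator. The Julia unitary
`[[A*, D_A], [D_{*,A}, -A]]` of a row contraction is a colligation whose input-output map is `M_A`
(`charFn_apply`).

Connecting the Julia colligations of `A` and `A'` through `U` gives a colligation on `H_A ⊕ H_{A'}`
with state operator `Â*` (`adjoint_rowOp_hatA`) and input-output map `diag(M_A, I) (I ⊗ U)
diag(I, M_{A'})` (`twoBlockProduct_apply`). So `Â*` is a corner of a unitary `[[Â*, β], [γ, δ]]`, and
`Â` is a row contraction. Pure contractivity says that `β` is injective, hence `γ` has dense range,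
and as `‖γ s‖ = ‖D_{*,Â} s‖`, the unitary `φ` is obtained from `γ = φ D_{*,Â}`
(`exists_codefect_unitary`).

Connecting the Julia colligation of `C` with this one through the unitary
`[[D_{*,λ}, λ], [-λ*, D_λ]]` gives, in the same way, a colligation with state operator `E'*`, whose
inputs are not lost either. Its upper right corner is therefore `D_{E'} τ` for a unitary `τ` onto
`𝒟_{E'}` (`exists_defect_unitary`).

It remains to compute the characteristic function of a lifting `E` of `C`. The dilation space of `C`
embeds isometrically into that of `E`: on `Γ ⊗ 𝒟_C` the embedding is `e_α ⊗ x ↦ V^E_α Q x`, where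
`Q : 𝒟_C → Ĥ_E` is an isometry with wandering range (`orthogonalFamily_wandering`). The range of the
embedding reduces `V^E`, which gives `W` and the formula `(M f)_α = Q* (V^E_α)* f`
(`exists_isLiftingCharFn`). For `E = E'` the vectors `(V^E_α)* f` follow the states of the
colligation of `E'`, and `Q*` reads off `D_{*,λ} g + λ y`, where `g` is the current input in
`𝒟_{*,λ}` and `y` the current output of the colligation of `Â` (`adjoint_wordOp_dilation_output`).
-/

open ContinuousLinearMap

noncomputable section

set_option linter.unusedSectionVars false

/-! ### Orthogonal sums and isometric extension -/

section HSumBasics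

variable {X Y Z S : Type*}
  [NormedAddCommGroup X] [InnerProductSpace ℂ X]
  [NormedAddCommGroup Y] [InnerProductSpace ℂ Y]
  [NormedAddCommGroup Z] [InnerProductSpace ℂ Z]
  [NormedAddCommGroup S] [InnerProductSpace ℂ S]

/-- The vector `x ⊕ y` of the orthogonal sum `X ⊕ Y`. -/
abbrev hpair (x : X) (y : Y) : HSum X Y := WithLp.toLp 2 (x, y)

theorem hsum_ext {u v : HSum X Y} (h₁ : u.fst = v.fst) (h₂ : u.snd = v.snd) : u = v :=
  WithLp.ofLp_injective 2 (Prod.ext h₁ h₂)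

theorem hpair_add (x x' : X) (y y' : Y) :
    hpair (x + x') (y + y') = hpair x y + hpair x' y' := rfl

theorem hpair_zero : hpair (0 : X) (0 : Y) = 0 := rfl

theorem hpair_eta (u : HSum X Y) : hpair u.fst u.snd = u := rfl

theorem hsum_norm_sq (u : HSum X Y) : ‖u‖ ^ 2 = ‖u.fst‖ ^ 2 + ‖u.snd‖ ^ 2 :=
  WithLp.prod_norm_sq_eq_of_L2 u

theorem hsum_inner (u v : HSum X Y) :
    inner ℂ u v = inner ℂ u.fst v.fst + inner ℂ u.snd v.snd := rfl

@[simp] theorem hinl_apply (x : X) : hinl X Y x = hpair x 0 := rfl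

@[simp] theorem hinr_apply (y : Y) : hinr X Y y = hpair 0 y := rfl

@[simp] theorem hfst_apply (u : HSum X Y) : hfst X Y u = u.fst := rfl

@[simp] theorem hsnd_apply (u : HSum X Y) : hsnd X Y u = u.snd := rfl

theorem htri_apply (P : X →L[ℂ] X) (Q : X →L[ℂ] Y) (R : Y →L[ℂ] Y) (u : HSum X Y) :
    htri P Q R u = hpair (P u.fst) (Q u.fst + R u.snd) := by
  refine hsum_ext ?_ ?_ <;> simp [htri]

theorem hdiag_apply {X' Y' : Type*} [NormedAddCommGroup X'] [InnerProductSpace ℂ X']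
    [NormedAddCommGroup Y'] [InnerProductSpace ℂ Y']
    (P : X →L[ℂ] X') (R : Y →L[ℂ] Y') (u : HSum X Y) :
    hdiag P R u = hpair (P u.fst) (R u.snd) := by
  refine hsum_ext ?_ ?_ <;> simp [hdiag]

theorem adjoint_htri_apply [CompleteSpace X] [CompleteSpace Y]
    (P : X →L[ℂ] X) (Q : X →L[ℂ] Y) (R : Y →L[ℂ] Y) (u : HSum X Y) :
    adjoint (htri P Q R) u = hpair (adjoint P u.fst + adjoint Q u.snd) (adjoint R u.snd) := by
  refine ext_inner_right ℂ fun v => ?_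
  rw [adjoint_inner_left, htri_apply, hsum_inner, hsum_inner]
  simp only [WithLp.toLp_fst, WithLp.toLp_snd, inner_add_left, inner_add_right,
    adjoint_inner_left]
  ring

/-- Two operators with dense ranges and the same seminorms `‖P s‖ = ‖R s‖` differ by a unitary. -/
theorem exists_unitary_of_norm_eq [CompleteSpace Z] [CompleteSpace Y]
    (P : S →L[ℂ] Z) (R : S →L[ℂ] Y) (hP : DenseRange P) (hR : DenseRange R)
    (h : ∀ s, ‖R s‖ = ‖P s‖) : ∃ Q : Z ≃ₗᵢ[ℂ] Y, ∀ s, Q (P s) = R s :=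
  ⟨(LinearEquiv.refl ℂ S).extendOfIsometry P.toLinearMap R.toLinearMap hP hR h,
    fun s => LinearEquiv.extendOfIsometry_eq (LinearEquiv.refl ℂ S) _ _ hP hR h s⟩

/-- An operator `R` with the seminorms `‖R s‖ = ‖P s‖` of an operator `P` with dense range factors
through `P` by an isometry. -/
theorem exists_isometry_of_norm_eq [CompleteSpace Y]
    (P : S →L[ℂ] Z) (R : S →L[ℂ] Y) (hP : DenseRange P)
    (h : ∀ s, ‖R s‖ = ‖P s‖) : ∃ Q : Z →ₗᵢ[ℂ] Y, ∀ s, Q (P s) = R s := by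
  have hb : ∃ C, ∀ s, ‖R.toLinearMap s‖ ≤ C * ‖P.toLinearMap s‖ :=
    ⟨1, fun s => by simp [h s]⟩
  have hQ : ∀ s, R.toLinearMap.extendOfNorm P.toLinearMap (P s) = R s :=
    fun s => LinearMap.extendOfNorm_eq hP hb s
  refine ⟨⟨(R.toLinearMap.extendOfNorm P.toLinearMap).toLinearMap, fun z => ?_⟩, hQ⟩
  refine hP.induction_on (p := fun z => ‖R.toLinearMap.extendOfNorm P.toLinearMap z‖ = ‖z‖) z
    (isClosed_eq (by fun_prop) (by fun_prop)) fun s => ?_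
  rw [hQ, h]

/-- `X^d ⊕ Y^d = (X ⊕ Y)^d`. -/
def combine (d : ℕ) (X Y : Type*) [NormedAddCommGroup X] [InnerProductSpace ℂ X]
    [NormedAddCommGroup Y] [InnerProductSpace ℂ Y] :
    HSum (Copies d X) (Copies d Y) ≃ₗᵢ[ℂ] Copies d (HSum X Y) where
  toFun u := WithLp.toLp 2 fun k => hpair (u.fst k) (u.snd k)
  invFun v := hpair (WithLp.toLp 2 fun k => (v k).fst) (WithLp.toLp 2 fun k => (v k).snd)
  left_inv _ := rfl
  right_inv _ := rfl
  map_add' _ _ := rfl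
  map_smul' _ _ := rfl
  norm_map' u := by
    refine (sq_eq_sq₀ (norm_nonneg _) (norm_nonneg _)).1 ?_
    rw [hsum_norm_sq, PiLp.norm_sq_eq_of_L2, PiLp.norm_sq_eq_of_L2, PiLp.norm_sq_eq_of_L2,
      ← Finset.sum_add_distrib]
    exact Finset.sum_congr rfl fun k _ => hsum_norm_sq _

end HSumBasics

/-! ### Defect operators and the Julia unitary -/

section Julia

variable {X Y : Type*}
  [NormedAddCommGroup X] [InnerProductSpace ℂ X] [CompleteSpace X]
  [NormedAddCommGroup Y] [InnerProductSpace ℂ Y] [CompleteSpace Y]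

theorem adjoint_defect (T : X →L[ℂ] Y) : adjoint (defect T) = defect T :=
  (IsSelfAdjoint.of_nonneg (defect_nonneg T)).adjoint_eq

theorem adjoint_codefect (T : X →L[ℂ] Y) : adjoint (codefect T) = codefect T :=
  (IsSelfAdjoint.of_nonneg (codefect_nonneg T)).adjoint_eq

theorem defect_adjoint (T : X →L[ℂ] Y) : defect (adjoint T) = codefect T := by
  rw [defect, codefect, adjoint_adjoint]

theorem codefect_adjoint (T : X →L[ℂ] Y) : codefect (adjoint T) = defect T := by
  rw [defect, codefect, adjoint_adjoint]

theorem defectSpace_adjoint (T : X →L[ℂ] Y) : defectSpace (adjoint T) = codefectSpace T := by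
  rw [defectSpace, codefectSpace, defect_adjoint]

theorem codefectSpace_adjoint (T : X →L[ℂ] Y) : codefectSpace (adjoint T) = defectSpace T := by
  rw [defectSpace, codefectSpace, codefect_adjoint]

@[simp] theorem coe_toDefect (T : X →L[ℂ] Y) (x : X) : (toDefect T x : X) = defect T x := rfl

@[simp] theorem coe_toCodefect (T : X →L[ℂ] Y) (y : Y) : (toCodefect T y : Y) = codefect T y := rfl

theorem denseRange_toDefect (T : X →L[ℂ] Y) : DenseRange (toDefect T) := by
  intro x
  rw [Topology.IsInducing.subtypeVal.closure_eq_preimage_closure_image, ← Set.range_comp]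
  exact x.2

theorem denseRange_toCodefect (T : X →L[ℂ] Y) : DenseRange (toCodefect T) := by
  intro x
  rw [Topology.IsInducing.subtypeVal.closure_eq_preimage_closure_image, ← Set.range_comp]
  exact x.2

theorem norm_sq_defect {T : X →L[ℂ] Y} (hT : ‖T‖ ≤ 1) (x : X) :
    ‖defect T x‖ ^ 2 = ‖x‖ ^ 2 - ‖T x‖ ^ 2 := by
  have h := julia_norm hT 0 x
  simp only [map_zero, zero_add, zero_sub, norm_neg, norm_zero] at h
  linarith

theorem norm_sq_codefect {T : X →L[ℂ] Y} (hT : ‖T‖ ≤ 1) (y : Y) :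
    ‖codefect T y‖ ^ 2 = ‖y‖ ^ 2 - ‖adjoint T y‖ ^ 2 := by
  have h := julia_norm hT y 0
  simp only [map_zero, add_zero, sub_zero, norm_zero] at h
  linarith

theorem inner_toDefect (T : X →L[ℂ] Y) (x : X) (z : defectSpace T) :
    inner ℂ (toDefect T x) z = inner ℂ x (defect T z) := by
  rw [Submodule.coe_inner, coe_toDefect, ← adjoint_inner_right, adjoint_defect]

theorem inner_toCodefect (T : X →L[ℂ] Y) (y : Y) (z : codefectSpace T) :
    inner ℂ (toCodefect T y) z = inner ℂ y (codefect T z) := by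
  rw [Submodule.coe_inner, coe_toCodefect, ← adjoint_inner_right, adjoint_codefect]

/-- `D_T` is injective on `𝒟_T`. -/
theorem eq_zero_of_defect_eq_zero (T : X →L[ℂ] Y) {z : defectSpace T} (h : defect T z = 0) :
    z = 0 :=
  (denseRange_toDefect T).eq_zero_of_inner_left ℂ fun x => by
    rw [← inner_conj_symm, inner_toDefect, h, inner_zero_right, map_zero]

/-- `D_{*,T}` is injective on `𝒟_{*,T}`. -/
theorem eq_zero_of_codefect_eq_zero (T : X →L[ℂ] Y) {z : codefectSpace T}
    (h : codefect T z = 0) : z = 0 :=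
  (denseRange_toCodefect T).eq_zero_of_inner_left ℂ fun x => by
    rw [← inner_conj_symm, inner_toCodefect, h, inner_zero_right, map_zero]

theorem comp_defect_apply {T : X →L[ℂ] Y} (hT : ‖T‖ ≤ 1) (x : X) :
    T (defect T x) = codefect T (T x) :=
  congrArg (fun R => R x) (comp_defect hT)

theorem adjoint_codefect_apply {T : X →L[ℂ] Y} (hT : ‖T‖ ≤ 1) (y : Y) :
    adjoint T (codefect T y) = defect T (adjoint T y) := by
  have h := comp_defect_apply (T := adjoint T) (by simpa using hT) y
  rwa [defect_adjoint, codefect_adjoint] at h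

theorem defect_defect_apply {T : X →L[ℂ] Y} (hT : ‖T‖ ≤ 1) (x : X) :
    defect T (defect T x) = x - adjoint T (T x) :=
  congrArg (fun R => R x) (defect_mul_self hT)

theorem codefect_codefect_apply {T : X →L[ℂ] Y} (hT : ‖T‖ ≤ 1) (y : Y) :
    codefect T (codefect T y) = y - T (adjoint T y) :=
  congrArg (fun R => R y) (codefect_mul_self hT)

theorem adjoint_mem_defectSpace {T : X →L[ℂ] Y} (hT : ‖T‖ ≤ 1) (y : codefectSpace T) :
    adjoint T y ∈ defectSpace T := by
  have h := map_defectSpace (T := adjoint T) (by simpa using hT)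
    ⟨y, by rw [defectSpace_adjoint]; exact y.2⟩
  rwa [codefectSpace_adjoint] at h

@[simp] theorem coe_restrictDefect {T : X →L[ℂ] Y} (hT : ‖T‖ ≤ 1) (x : defectSpace T) :
    (restrictDefect T hT x : Y) = T x := rfl

/-- The Julia operator `[[T*, D_T], [D_{*,T}, -T]] : Y ⊕ 𝒟_T → X ⊕ 𝒟_{*,T}` of a contraction
`T : X → Y`; it is unitary. -/
def julia (T : X →L[ℂ] Y) (hT : ‖T‖ ≤ 1) :
    HSum Y (defectSpace T) ≃ₗᵢ[ℂ] HSum X (codefectSpace T) where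
  toFun u := hpair (adjoint T u.fst + defect T u.snd)
    (toCodefect T u.fst - restrictDefect T hT u.snd)
  invFun v := hpair (T v.fst + codefect T v.snd)
    (toDefect T v.fst - ⟨adjoint T v.snd, adjoint_mem_defectSpace hT v.snd⟩)
  left_inv u := by
    refine hsum_ext ?_ (Subtype.ext ?_)
    · simp [codefect_codefect_apply hT, comp_defect_apply hT]
    · simp [defect_defect_apply hT, adjoint_codefect_apply hT]
  right_inv v := by
    refine hsum_ext ?_ (Subtype.ext ?_)
    · simp [defect_defect_apply hT, adjoint_codefect_apply hT]
    · simp [codefect_codefect_apply hT, comp_defect_apply hT]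
  map_add' u v := by
    refine hsum_ext ?_ ?_
    · change adjoint T (u.fst + v.fst) + defect T ((u.snd : X) + v.snd) =
        (adjoint T u.fst + defect T u.snd) + (adjoint T v.fst + defect T v.snd)
      rw [map_add, map_add, add_add_add_comm]
    · change toCodefect T (u.fst + v.fst) - restrictDefect T hT (u.snd + v.snd) =
        (toCodefect T u.fst - restrictDefect T hT u.snd) +
          (toCodefect T v.fst - restrictDefect T hT v.snd)
      rw [map_add, map_add, add_sub_add_comm]
  map_smul' c u := by
    refine hsum_ext ?_ ?_
    · change adjoint T (c • u.fst) + defect T (c • (u.snd : X)) =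
        c • (adjoint T u.fst + defect T u.snd)
      rw [map_smul, map_smul, smul_add]
    · change toCodefect T (c • u.fst) - restrictDefect T hT (c • u.snd) =
        c • (toCodefect T u.fst - restrictDefect T hT u.snd)
      rw [map_smul, map_smul, smul_sub]
  norm_map' u := by
    refine (sq_eq_sq₀ (norm_nonneg _) (norm_nonneg _)).1 ?_
    rw [hsum_norm_sq, hsum_norm_sq]
    exact julia_norm hT u.fst u.snd

theorem julia_apply_fst {T : X →L[ℂ] Y} (hT : ‖T‖ ≤ 1) (u : HSum Y (defectSpace T)) :
    (julia T hT u).fst = adjoint T u.fst + defect T u.snd := rfl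

theorem julia_apply_snd {T : X →L[ℂ] Y} (hT : ‖T‖ ≤ 1) (u : HSum Y (defectSpace T)) :
    (julia T hT u).snd = toCodefect T u.fst - restrictDefect T hT u.snd := rfl

end Julia

/-! ### Corners of unitary operators -/

section Corner

variable {S S' X Y : Type*}
  [NormedAddCommGroup S] [InnerProductSpace ℂ S]
  [NormedAddCommGroup S'] [InnerProductSpace ℂ S']
  [NormedAddCommGroup X] [InnerProductSpace ℂ X]
  [NormedAddCommGroup Y] [InnerProductSpace ℂ Y]

/-- The lower left corner `S → Y` of a unitary `S ⊕ X → S' ⊕ Y`. -/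
def lowerCorner (𝒱 : HSum S X ≃ₗᵢ[ℂ] HSum S' Y) : S →L[ℂ] Y :=
  hsnd S' Y ∘L 𝒱.toContinuousLinearEquiv.toContinuousLinearMap ∘L hinl S X

@[simp] theorem lowerCorner_apply (𝒱 : HSum S X ≃ₗᵢ[ℂ] HSum S' Y) (s : S) :
    lowerCorner 𝒱 s = (𝒱 (hpair s 0)).snd := rfl

theorem norm_sq_lowerCorner (𝒱 : HSum S X ≃ₗᵢ[ℂ] HSum S' Y) (s : S) :
    ‖lowerCorner 𝒱 s‖ ^ 2 = ‖s‖ ^ 2 - ‖(𝒱 (hpair s 0)).fst‖ ^ 2 := by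
  have h := hsum_norm_sq (𝒱 (hpair s 0))
  rw [𝒱.norm_map, hsum_norm_sq] at h
  simp only [WithLp.toLp_fst, WithLp.toLp_snd, norm_zero] at h
  rw [lowerCorner_apply]
  linarith

theorem denseRange_lowerCorner [CompleteSpace Y] (𝒱 : HSum S X ≃ₗᵢ[ℂ] HSum S' Y)
    (hinj : ∀ y, (𝒱.symm (hpair 0 y)).fst = 0 → y = 0) : DenseRange (lowerCorner 𝒱) := by
  have h : (LinearMap.range (lowerCorner 𝒱).toLinearMap)ᗮ = ⊥ := by
    rw [Submodule.eq_bot_iff]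
    intro y hy
    refine hinj y (ext_inner_left ℂ fun s => ?_)
    have h1 := Submodule.inner_right_of_mem_orthogonal
      (LinearMap.mem_range_self (lowerCorner 𝒱).toLinearMap s) hy
    have h2 := 𝒱.inner_map_map (hpair s 0) (𝒱.symm (hpair 0 y))
    rw [𝒱.apply_symm_apply, hsum_inner, hsum_inner] at h2
    simp only [WithLp.toLp_fst, WithLp.toLp_snd, inner_zero_left, inner_zero_right, add_zero,
      zero_add] at h2
    rw [inner_zero_right, ← h2]
    exact h1
  have h3 := Submodule.dense_iff_topologicalClosure_eq_top.2
    ((Submodule.topologicalClosure_eq_top_iff).2 h)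
  exact h3

/-- The hypothesis on the second column of a unitary passes to that of its adjoint. -/
theorem symm_injective_of_injective (𝒱 : HSum S X ≃ₗᵢ[ℂ] HSum S' Y)
    (hinj : ∀ x, (𝒱 (hpair 0 x)).fst = 0 → x = 0) (y : Y)
    (hy : (𝒱.symm (hpair 0 y)).fst = 0) : y = 0 := by
  have h1 : 𝒱.symm (hpair 0 y) = hpair 0 (𝒱.symm (hpair 0 y)).snd := hsum_ext hy rfl
  have h2 : 𝒱 (hpair 0 (𝒱.symm (hpair 0 y)).snd) = hpair 0 y := by
    rw [← h1, 𝒱.apply_symm_apply]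
  have h3 := hinj _ (congrArg WithLp.fst h2)
  rw [h3, hpair_zero, map_zero] at h2
  exact (congrArg WithLp.snd h2).symm

variable [CompleteSpace S] [CompleteSpace S']

/-- The upper left corner of the inverse of a unitary is the adjoint of its upper left corner. -/
theorem corner_symm_apply (𝒱 : HSum S X ≃ₗᵢ[ℂ] HSum S' Y) (T : S' →L[ℂ] S)
    (hT : ∀ s, adjoint T s = (𝒱 (hpair s 0)).fst) (t : S') :
    T t = (𝒱.symm (hpair t 0)).fst := by
  refine ext_inner_right ℂ fun s => ?_
  have h := 𝒱.inner_map_map (𝒱.symm (hpair t 0)) (hpair s 0)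
  rw [𝒱.apply_symm_apply, hsum_inner, hsum_inner] at h
  simp only [WithLp.toLp_fst, WithLp.toLp_snd, inner_zero_left, inner_zero_right, add_zero] at h
  rw [← h, ← hT, adjoint_inner_right]

theorem norm_le_one_of_corner (𝒱 : HSum S X ≃ₗᵢ[ℂ] HSum S' Y) (T : S' →L[ℂ] S)
    (hT : ∀ s, adjoint T s = (𝒱 (hpair s 0)).fst) : ‖T‖ ≤ 1 := by
  rw [← LinearIsometryEquiv.norm_map adjoint T]
  refine ContinuousLinearMap.opNorm_le_bound _ zero_le_one fun s => ?_
  have h := norm_sq_lowerCorner 𝒱 s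
  rw [hT, one_mul]
  refine le_of_sq_le_sq ?_ (norm_nonneg _)
  nlinarith [sq_nonneg ‖lowerCorner 𝒱 s‖]

/-- If `T*` is the upper left corner of a unitary `𝒱 = [[T*, β], [γ, δ]]` with `β` injective, then
`γ = φ D_{*,T}` for a unitary `φ` defined on `𝒟_{*,T}`: both operators have the same seminorms
`‖γ s‖² = ‖s‖² - ‖T* s‖² = ‖D_{*,T} s‖²`, and injectivity of `β` makes the range of `γ` dense. -/
theorem exists_codefect_unitary [CompleteSpace Y] (𝒱 : HSum S X ≃ₗᵢ[ℂ] HSum S' Y) (T : S' →L[ℂ] S)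
    (hT : ∀ s, adjoint T s = (𝒱 (hpair s 0)).fst)
    (hinj : ∀ x, (𝒱 (hpair 0 x)).fst = 0 → x = 0) :
    ∃ φ : codefectSpace T ≃ₗᵢ[ℂ] Y, ∀ s, φ (toCodefect T s) = (𝒱 (hpair s 0)).snd := by
  refine exists_unitary_of_norm_eq (toCodefect T) (lowerCorner 𝒱) (denseRange_toCodefect T)
    (denseRange_lowerCorner 𝒱 (symm_injective_of_injective 𝒱 hinj)) fun s => ?_
  refine (sq_eq_sq₀ (norm_nonneg _) (norm_nonneg _)).1 ?_
  rw [norm_sq_lowerCorner, Submodule.coe_norm, coe_toCodefect,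
    norm_sq_codefect (norm_le_one_of_corner 𝒱 T hT), hT]

/-- In the situation of `exists_codefect_unitary`, `β = D_T τ` for a unitary `τ` onto `𝒟_T`. -/
theorem exists_defect_unitary [CompleteSpace X] (𝒱 : HSum S X ≃ₗᵢ[ℂ] HSum S' Y) (T : S' →L[ℂ] S)
    (hT : ∀ s, adjoint T s = (𝒱 (hpair s 0)).fst)
    (hinj : ∀ x, (𝒱 (hpair 0 x)).fst = 0 → x = 0) :
    ∃ τ : X ≃ₗᵢ[ℂ] defectSpace T, ∀ x, defect T (τ x) = (𝒱 (hpair 0 x)).fst := by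
  obtain ⟨Q, hQ⟩ := exists_unitary_of_norm_eq (toDefect T) (lowerCorner 𝒱.symm)
    (denseRange_toDefect T) (denseRange_lowerCorner 𝒱.symm hinj) fun t => by
      refine (sq_eq_sq₀ (norm_nonneg _) (norm_nonneg _)).1 ?_
      rw [norm_sq_lowerCorner, Submodule.coe_norm, coe_toDefect,
        norm_sq_defect (norm_le_one_of_corner 𝒱 T hT), ← corner_symm_apply 𝒱 T hT]
  refine ⟨Q.symm, fun x => ext_inner_left ℂ fun t => ?_⟩
  have h := 𝒱.inner_map_map (𝒱.symm (hpair t 0)) (hpair 0 x)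
  rw [𝒱.apply_symm_apply, hsum_inner, hsum_inner] at h
  simp only [WithLp.toLp_fst, WithLp.toLp_snd, inner_zero_left, inner_zero_right, add_zero,
    zero_add] at h
  rw [h, ← inner_toDefect, ← Q.inner_map_map, hQ, Q.apply_symm_apply]
  rfl

end Corner

/-! ### Colligations and their outputs -/

section Cascade

variable {S₁ S₂ T₁ T₂ X₁ X₂ Y₁ Y₂ F G : Type*}
  [NormedAddCommGroup S₁] [InnerProductSpace ℂ S₁]
  [NormedAddCommGroup S₂] [InnerProductSpace ℂ S₂]
  [NormedAddCommGroup T₁] [InnerProductSpace ℂ T₁]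
  [NormedAddCommGroup T₂] [InnerProductSpace ℂ T₂]
  [NormedAddCommGroup X₁] [InnerProductSpace ℂ X₁]
  [NormedAddCommGroup X₂] [InnerProductSpace ℂ X₂]
  [NormedAddCommGroup Y₁] [InnerProductSpace ℂ Y₁]
  [NormedAddCommGroup Y₂] [InnerProductSpace ℂ Y₂]
  [NormedAddCommGroup F] [InnerProductSpace ℂ F]
  [NormedAddCommGroup G] [InnerProductSpace ℂ G]

/-- The connection of two unitaries `𝒱₁ : S₁ ⊕ X₁ → T₁ ⊕ Y₁` and `𝒱₂ : S₂ ⊕ X₂ → T₂ ⊕ Y₂` through a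
unitary `U : F ⊕ Y₂ → X₁ ⊕ G`: the output of `𝒱₂`, together with a vector of `F`, is sent through
`U`, and the component of the result in `X₁` is the input of `𝒱₁`. -/
def cascade (𝒱₁ : HSum S₁ X₁ ≃ₗᵢ[ℂ] HSum T₁ Y₁) (𝒱₂ : HSum S₂ X₂ ≃ₗᵢ[ℂ] HSum T₂ Y₂)
    (U : HSum F Y₂ ≃ₗᵢ[ℂ] HSum X₁ G) :
    HSum (HSum S₁ S₂) (HSum F X₂) ≃ₗᵢ[ℂ] HSum (HSum T₁ T₂) (HSum Y₁ G) where
  toFun u :=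
    let p := 𝒱₂ (hpair u.fst.snd u.snd.snd)
    let q := U (hpair u.snd.fst p.snd)
    let r := 𝒱₁ (hpair u.fst.fst q.fst)
    hpair (hpair r.fst p.fst) (hpair r.snd q.snd)
  invFun v :=
    let r := 𝒱₁.symm (hpair v.fst.fst v.snd.fst)
    let q := U.symm (hpair r.snd v.snd.snd)
    let p := 𝒱₂.symm (hpair v.fst.snd q.snd)
    hpair (hpair r.fst p.fst) (hpair q.fst p.snd)
  left_inv u := by
    simp only [hpair_eta, WithLp.toLp_fst, WithLp.toLp_snd, LinearIsometryEquiv.symm_apply_apply]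
  right_inv v := by
    simp only [hpair_eta, WithLp.toLp_fst, WithLp.toLp_snd, LinearIsometryEquiv.apply_symm_apply]
  map_add' u v := by
    have hp : 𝒱₂ (hpair (u + v).fst.snd (u + v).snd.snd) =
        𝒱₂ (hpair u.fst.snd u.snd.snd) + 𝒱₂ (hpair v.fst.snd v.snd.snd) := by
      rw [← map_add]; rfl
    have hq : ∀ a b : HSum T₂ Y₂, U (hpair (u + v).snd.fst (a + b).snd) =
        U (hpair u.snd.fst a.snd) + U (hpair v.snd.fst b.snd) := fun a b => by
      rw [← map_add]; rfl
    have hr : ∀ a b : HSum X₁ G, 𝒱₁ (hpair (u + v).fst.fst (a + b).fst) =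
        𝒱₁ (hpair u.fst.fst a.fst) + 𝒱₁ (hpair v.fst.fst b.fst) := fun a b => by
      rw [← map_add]; rfl
    simp only [hp, hq, hr]
    rfl
  map_smul' c u := by
    have hp : 𝒱₂ (hpair (c • u).fst.snd (c • u).snd.snd) = c • 𝒱₂ (hpair u.fst.snd u.snd.snd) := by
      rw [← map_smul]; rfl
    have hq : ∀ a : HSum T₂ Y₂, U (hpair (c • u).snd.fst (c • a).snd) =
        c • U (hpair u.snd.fst a.snd) := fun a => by
      rw [← map_smul]; rfl
    have hr : ∀ a : HSum X₁ G, 𝒱₁ (hpair (c • u).fst.fst (c • a).fst) =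
        c • 𝒱₁ (hpair u.fst.fst a.fst) := fun a => by
      rw [← map_smul]; rfl
    simp only [hp, hq, hr]
    rfl
  norm_map' u := by
    have hp := 𝒱₂.norm_map (hpair u.fst.snd u.snd.snd)
    set p := 𝒱₂ (hpair u.fst.snd u.snd.snd)
    have hq := U.norm_map (hpair u.snd.fst p.snd)
    set q := U (hpair u.snd.fst p.snd)
    have hr := 𝒱₁.norm_map (hpair u.fst.fst q.fst)
    set r := 𝒱₁ (hpair u.fst.fst q.fst)
    rw [← sq_eq_sq₀ (norm_nonneg _) (norm_nonneg _), hsum_norm_sq, hsum_norm_sq] at hp hq hr ⊢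
    have h1 := hsum_norm_sq u.fst
    have h2 := hsum_norm_sq u.snd
    have h4 := hsum_norm_sq (hpair r.snd q.snd)
    change ‖r.fst‖ ^ 2 + ‖p.fst‖ ^ 2 + ‖hpair r.snd q.snd‖ ^ 2 = _
    rw [hsum_norm_sq u]
    simp only [WithLp.toLp_fst, WithLp.toLp_snd] at hp hq hr h4
    linarith

end Cascade

section Colligation

variable {d : ℕ} {S S₁ S₂ X Y X₁ X₂ Y₁ Y₂ F G : Type*}
  [NormedAddCommGroup S] [InnerProductSpace ℂ S]
  [NormedAddCommGroup S₁] [InnerProductSpace ℂ S₁]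
  [NormedAddCommGroup S₂] [InnerProductSpace ℂ S₂]
  [NormedAddCommGroup X] [InnerProductSpace ℂ X]
  [NormedAddCommGroup Y] [InnerProductSpace ℂ Y]
  [NormedAddCommGroup X₁] [InnerProductSpace ℂ X₁]
  [NormedAddCommGroup X₂] [InnerProductSpace ℂ X₂]
  [NormedAddCommGroup Y₁] [InnerProductSpace ℂ Y₁]
  [NormedAddCommGroup Y₂] [InnerProductSpace ℂ Y₂]
  [NormedAddCommGroup F] [InnerProductSpace ℂ F]
  [NormedAddCommGroup G] [InnerProductSpace ℂ G]

/-- A unitary colligation with state space `S`, input space `X` and output space `Y`: a unitary that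
sends a state and an input to `d` new states, one for each letter, and an output. -/
abbrev Colligation (d : ℕ) (S X Y : Type*) [NormedAddCommGroup S] [InnerProductSpace ℂ S]
    [NormedAddCommGroup X] [InnerProductSpace ℂ X]
    [NormedAddCommGroup Y] [InnerProductSpace ℂ Y] : Type _ :=
  HSum S X ≃ₗᵢ[ℂ] HSum (Copies d S) Y

theorem Colligation.apply_fst_eq_add (𝒱 : Colligation d S X Y) (s : S) (x : X) :
    (𝒱 (hpair s x)).fst = (𝒱 (hpair s 0)).fst + (𝒱 (hpair 0 x)).fst := by
  have h : hpair s x = hpair s 0 + hpair 0 x := by rw [← hpair_add, add_zero, zero_add]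
  rw [h, map_add]
  rfl

theorem Colligation.apply_snd_eq_add (𝒱 : Colligation d S X Y) (s : S) (x : X) :
    (𝒱 (hpair s x)).snd = (𝒱 (hpair s 0)).snd + (𝒱 (hpair 0 x)).snd := by
  have h : hpair s x = hpair s 0 + hpair 0 x := by rw [← hpair_add, add_zero, zero_add]
  rw [h, map_add]
  rfl

/-- The output at the word `β` of a colligation with initial state `s` and input family `f`; the
letters of `β` say which of the `d` new states is taken at each step. -/
def output (𝒱 : Colligation d S X Y) : List (Fin d) → S → (List (Fin d) → X) → Y
  | [], s, f => (𝒱 (hpair s (f []))).snd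
  | k :: β, s, f => output 𝒱 β ((𝒱 (hpair s (f []))).fst k) fun α => f (k :: α)

/-- `cascade` for colligations. -/
def Colligation.cascade (𝒱₁ : Colligation d S₁ X₁ Y₁) (𝒱₂ : Colligation d S₂ X₂ Y₂)
    (U : HSum F Y₂ ≃ₗᵢ[ℂ] HSum X₁ G) :
    Colligation d (HSum S₁ S₂) (HSum F X₂) (HSum Y₁ G) :=
  (_root_.cascade 𝒱₁ 𝒱₂ U).trans
    (LinearIsometryEquiv.withLpProdCongr 2 (combine d S₁ S₂) (LinearIsometryEquiv.refl ℂ _))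

theorem Colligation.cascade_apply_fst (𝒱₁ : Colligation d S₁ X₁ Y₁) (𝒱₂ : Colligation d S₂ X₂ Y₂)
    (U : HSum F Y₂ ≃ₗᵢ[ℂ] HSum X₁ G) (s₁ : S₁) (s₂ : S₂) (f : F) (x : X₂) :
    (𝒱₁.cascade 𝒱₂ U (hpair (hpair s₁ s₂) (hpair f x))).fst =
      combine d S₁ S₂ (hpair (𝒱₁ (hpair s₁ (U (hpair f (𝒱₂ (hpair s₂ x)).snd)).fst)).fst
        (𝒱₂ (hpair s₂ x)).fst) := rfl

theorem output_cascade (𝒱₁ : Colligation d S₁ X₁ Y₁) (𝒱₂ : Colligation d S₂ X₂ Y₂)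
    (U : HSum F Y₂ ≃ₗᵢ[ℂ] HSum X₁ G) (β : List (Fin d)) (s₁ : S₁) (s₂ : S₂)
    (f : List (Fin d) → F) (g : List (Fin d) → X₂) :
    output (𝒱₁.cascade 𝒱₂ U) β (hpair s₁ s₂) (fun α => hpair (f α) (g α)) =
      hpair (output 𝒱₁ β s₁ fun α => (U (hpair (f α) (output 𝒱₂ α s₂ g))).fst)
        (U (hpair (f β) (output 𝒱₂ β s₂ g))).snd := by
  induction β generalizing s₁ s₂ f g with
  | nil => rfl
  | cons k β ih => exact ih _ _ (fun α => f (k :: α)) (fun α => g (k :: α))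

end Colligation

/-! ### Operators on Fock spaces entrywise -/

section FockEntries

variable {d : ℕ} {X Y X' Y' : Type*}
  [NormedAddCommGroup X] [InnerProductSpace ℂ X]
  [NormedAddCommGroup Y] [InnerProductSpace ℂ Y]
  [NormedAddCommGroup X'] [InnerProductSpace ℂ X']
  [NormedAddCommGroup Y'] [InnerProductSpace ℂ Y']

@[simp] theorem ampl_apply (T : X →L[ℂ] Y) (f : Fock d X) (β : List (Fin d)) :
    ampl d T f β = T (f β) := rfl

theorem fockDiag_apply (M : Fock d X →L[ℂ] Fock d X') (N : Fock d Y →L[ℂ] Fock d Y')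
    (f : Fock d (HSum X Y)) (β : List (Fin d)) :
    fockDiag M N f β = hpair (M (ampl d (hfst X Y) f) β) (N (ampl d (hsnd X Y) f) β) := by
  refine hsum_ext ?_ ?_ <;> simp [fockDiag]

theorem vac_nil (x : X) : vac d X x [] = x := by
  simp [vac]

@[simp] theorem creation_nil (j : Fin d) (f : Fock d X) : creation X j f [] = 0 := rfl

theorem creation_cons (j k : Fin d) (f : Fock d X) (β : List (Fin d)) :
    creation X j f (k :: β) = if k = j then f β else 0 := rfl

end FockEntries

/-! ### Row contractions and liftings as corners of colligations -/

section RowCorner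

variable {d : ℕ} {H HC HA : Type*}
  [NormedAddCommGroup H] [InnerProductSpace ℂ H] [CompleteSpace H]
  [NormedAddCommGroup HC] [InnerProductSpace ℂ HC] [CompleteSpace HC]
  [NormedAddCommGroup HA] [InnerProductSpace ℂ HA] [CompleteSpace HA]

theorem rowOp_apply (S : Fin d → H →L[ℂ] H) (v : Copies d H) : rowOp S v = ∑ i, S i (v i) := by
  rw [rowOp, sum_apply]
  rfl

theorem isRowContraction_of_norm_le {S : Fin d → H →L[ℂ] H} (h : ‖rowOp S‖ ≤ 1) :
    IsRowContraction S := by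
  have h1 : ∑ i, S i ∘L adjoint (S i) = rowOp S ∘L adjoint (rowOp S) := by
    refine ContinuousLinearMap.ext fun x => ?_
    simp only [sum_apply, comp_apply, rowOp_apply, adjoint_rowOp_apply]
  rw [IsRowContraction, h1]
  exact sub_nonneg.1 (one_sub_comp_adjoint_nonneg h)

theorem adjoint_slot_apply (k : Fin d) (v : Copies d H) : adjoint (slot H k) v = v k := by
  refine ext_inner_right ℂ fun h => ?_
  rw [adjoint_inner_left, PiLp.inner_apply, Finset.sum_eq_single k]
  · simp [slot]
  · intro j _ hj; simp [slot, hj]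
  · simp

theorem adjoint_toDefect_apply {X Y : Type*}
    [NormedAddCommGroup X] [InnerProductSpace ℂ X] [CompleteSpace X]
    [NormedAddCommGroup Y] [InnerProductSpace ℂ Y] [CompleteSpace Y]
    (T : X →L[ℂ] Y) (z : defectSpace T) : adjoint (toDefect T) z = defect T z := by
  refine ext_inner_left ℂ fun x => ?_
  rw [adjoint_inner_right, inner_toDefect]

theorem adjoint_codefectOn_apply {X Y : Type*}
    [NormedAddCommGroup X] [InnerProductSpace ℂ X] [CompleteSpace X]
    [NormedAddCommGroup Y] [InnerProductSpace ℂ Y] [CompleteSpace Y]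
    (T : X →L[ℂ] Y) (y : Y) : adjoint (codefectOn T) y = toCodefect T y := by
  refine ext_inner_right ℂ fun z => ?_
  rw [adjoint_inner_left, inner_toCodefect]
  rfl

theorem adjoint_rowOp_lifting (C : Fin d → HC →L[ℂ] HC) (B : Copies d HC →L[ℂ] HA)
    (A : Fin d → HA →L[ℂ] HA) (u : HSum HC HA) :
    adjoint (rowOp (lifting C B A)) u =
      combine d HC HA (hpair (adjoint (rowOp C) u.fst + adjoint B u.snd)
        (adjoint (rowOp A) u.snd)) := by
  ext1 k
  rw [adjoint_rowOp_apply, lifting, adjoint_htri_apply, adjoint_comp, comp_apply,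
    adjoint_slot_apply, ← adjoint_rowOp_apply, ← adjoint_rowOp_apply]
  rfl

theorem adjoint_wordOp_cons_apply (A : Fin d → H →L[ℂ] H) (k : Fin d) (β : List (Fin d)) (x : H) :
    adjoint (wordOp A (k :: β)) x = adjoint (wordOp A β) (adjoint (A k) x) := by
  have h : wordOp A (k :: β) = A k ∘L wordOp A β := by
    simp only [wordOp, List.map_cons, List.prod_cons]
    rfl
  rw [h, adjoint_comp, comp_apply]

theorem adjoint_wordOp_nil_apply (A : Fin d → H →L[ℂ] H) (x : H) :
    adjoint (wordOp A []) x = x := by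
  have h : wordOp A [] = ContinuousLinearMap.id ℂ H := rfl
  rw [h, adjoint_id, id_apply]

/-- The Julia unitary of a row contraction, as a colligation. -/
def juliaColligation (A : Fin d → H →L[ℂ] H) (hA : IsRowContraction A) :
    Colligation d H (defectSpace (rowOp A)) (codefectSpace (rowOp A)) :=
  julia (rowOp A) hA.norm_rowOp_le

theorem output_juliaColligation (A : Fin d → H →L[ℂ] H) (hA : IsRowContraction A)
    (β : List (Fin d)) (x : H) (f : List (Fin d) → defectSpace (rowOp A)) :
    output (juliaColligation A hA) β x f =
      toCodefect (rowOp A) (adjoint (wordOp A β) x) + symbolFun (charCoeff A hA) f β := by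
  induction β generalizing x f with
  | nil =>
    rw [symbolFun_nil, adjoint_wordOp_nil_apply]
    exact sub_eq_add_neg _ _
  | cons k β ih =>
    have h1 : (juliaColligation A hA (hpair x (f []))).fst k =
        adjoint (A k) x + defect (rowOp A) (f []) k := by
      rw [← adjoint_rowOp_apply]
      rfl
    rw [output, ih, h1, symbolFun_cons, adjoint_wordOp_cons_apply, map_add, map_add, add_assoc]
    rfl

/-- `M_A` is the input-output map of the Julia colligation with initial state `0`. -/
theorem charFn_apply (A : Fin d → H →L[ℂ] H) (hA : IsRowContraction A)
    (f : Fock d (defectSpace (rowOp A))) (β : List (Fin d)) :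
    charFn A hA f β = output (juliaColligation A hA) β 0 f := by
  rw [output_juliaColligation, map_zero, map_zero, zero_add]
  rfl

variable {HA' F Fs : Type*}
  [NormedAddCommGroup HA'] [InnerProductSpace ℂ HA'] [CompleteSpace HA']
  [NormedAddCommGroup F] [InnerProductSpace ℂ F] [CompleteSpace F]
  [NormedAddCommGroup Fs] [InnerProductSpace ℂ Fs] [CompleteSpace Fs]
  (A : Fin d → HA →L[ℂ] HA) (hA : IsRowContraction A)
  (A' : Fin d → HA' →L[ℂ] HA') (hA' : IsRowContraction A')
  (U : HSum F (codefectSpace (rowOp A')) ≃ₗᵢ[ℂ] HSum (defectSpace (rowOp A)) Fs)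

/-- The colligation on `H_A ⊕ H_{A'}` obtained by connecting the Julia colligations of `A` and `A'`
through `U`. -/
def hatColligation : Colligation d (HSum HA HA') (HSum F (defectSpace (rowOp A')))
    (HSum (codefectSpace (rowOp A)) Fs) :=
  (juliaColligation A hA).cascade (juliaColligation A' hA') U

theorem twoBlockProduct_apply (f : Fock d (HSum F (defectSpace (rowOp A')))) (β : List (Fin d)) :
    twoBlockProduct (charFn A hA) (charFn A' hA') U f β =
      output (hatColligation A hA A' hA' U) β 0 f := by
  have h := output_cascade (juliaColligation A hA) (juliaColligation A' hA') U β 0 0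
    (fun α => (f α).fst) (fun α => (f α).snd)
  simp only [hpair_eta, hpair_zero] at h
  rw [hatColligation, h, twoBlockProduct, comp_apply, fockDiag_apply, charFn_apply]
  have h2 : ∀ α, (ampl d U.toContinuousLinearEquiv.toContinuousLinearMap)
      ((fockDiag (ContinuousLinearMap.id ℂ (Fock d F)) (charFn A' hA')) f) α =
      U (hpair (f α).fst (output (juliaColligation A' hA') α 0 fun α => (f α).snd)) := fun α => by
    rw [ampl_apply, fockDiag_apply, charFn_apply]
    rfl
  simp only [comp_apply, id_apply, ampl_apply, hsnd_apply]
  exact congrArg₂ hpair (congrArg (output _ β 0) (funext fun α => congrArg WithLp.fst (h2 α)))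
    (congrArg WithLp.snd (h2 β))

theorem adjoint_adjointCorner_apply {X Y' : Type*}
    [NormedAddCommGroup X] [InnerProductSpace ℂ X] [CompleteSpace X]
    [NormedAddCommGroup Y'] [InnerProductSpace ℂ Y'] [CompleteSpace Y']
    (U : HSum F Y' ≃ₗᵢ[ℂ] HSum X Fs) (y : Y') :
    adjoint (adjointCorner U) y = (U (hpair 0 y)).fst := by
  refine ext_inner_right ℂ fun x => ?_
  have h := U.inner_map_map (hpair 0 y) (U.symm (hpair x 0))
  rw [U.apply_symm_apply, hsum_inner, hsum_inner] at h
  simp only [WithLp.toLp_fst, WithLp.toLp_snd, inner_zero_left, inner_zero_right, add_zero,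
    zero_add] at h
  rw [adjoint_inner_left, h]
  rfl

theorem adjoint_rowOp_hatA (u : HSum HA HA') :
    adjoint (rowOp (hatA A A' U)) u = (hatColligation A hA A' hA' U (hpair u 0)).fst := by
  rw [hatA, adjoint_rowOp_lifting, adjoint_comp, adjoint_comp, comp_apply, comp_apply,
    adjoint_toDefect_apply, adjoint_adjointCorner_apply, adjoint_codefectOn_apply]
  have h : (juliaColligation A' hA' (hpair u.snd 0)) =
      hpair (adjoint (rowOp A') u.snd) (toCodefect (rowOp A') u.snd) := by
    refine hsum_ext ?_ ?_
    · rw [juliaColligation, julia_apply_fst]; simp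
    · rw [juliaColligation, julia_apply_snd]; simp
  have h2 := Colligation.cascade_apply_fst (juliaColligation A hA) (juliaColligation A' hA') U
    u.fst u.snd 0 0
  rw [h] at h2
  exact h2.symm

/-- Pure contractivity of `diag(M_A, I) (I ⊗ U) diag(I, M_{A'})` says that no nonzero input vector
is sent by the colligation to the output alone. -/
theorem hatColligation_injective
    (hM : IsPurelyContractive (X := HSum F (defectSpace (rowOp A')))
      (Y := HSum (codefectSpace (rowOp A)) Fs)
      (twoBlockProduct (charFn A hA) (charFn A' hA') U))
    (x : HSum F (defectSpace (rowOp A')))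
    (hx : (hatColligation A hA A' hA' U (hpair 0 x)).fst = 0) : x = 0 := by
  by_contra hne
  have h1 := hM.2.2 x hne
  rw [twoBlockProduct_apply, output, vac_nil] at h1
  have h2 := hsum_norm_sq (hatColligation A hA A' hA' U (hpair 0 x))
  rw [hx, LinearIsometryEquiv.norm_map, hsum_norm_sq] at h2
  simp only [WithLp.toLp_fst, WithLp.toLp_snd, norm_zero] at h2
  have h3 := pow_lt_pow_left₀ h1 (norm_nonneg _) two_ne_zero
  linarith

end RowCorner

section LiftCorner

variable {d : ℕ} {HC HA X G K : Type*}
  [NormedAddCommGroup HC] [InnerProductSpace ℂ HC] [CompleteSpace HC]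
  [NormedAddCommGroup HA] [InnerProductSpace ℂ HA] [CompleteSpace HA]
  [NormedAddCommGroup X] [InnerProductSpace ℂ X] [CompleteSpace X]
  [NormedAddCommGroup G] [InnerProductSpace ℂ G] [CompleteSpace G]
  [NormedAddCommGroup K] [InnerProductSpace ℂ K] [CompleteSpace K]

/-- The unitary `[[D_{*,λ}, λ], [-λ*, D_λ]] : 𝒟_{*,λ} ⊕ G → K ⊕ 𝒟_λ` of a contraction `λ : G → K`:
the Julia unitary of `λ*` with the summands of its domain exchanged. -/
def rowUnitary (lam : G →L[ℂ] K) (hlam : ‖lam‖ ≤ 1) :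
    HSum (codefectSpace lam) G ≃ₗᵢ[ℂ] HSum K (codefectSpace (adjoint lam)) :=
  (LinearIsometryEquiv.withLpProdComm 2 ℂ (codefectSpace lam) G).trans
    ((LinearIsometryEquiv.withLpProdCongr 2 (LinearIsometryEquiv.refl ℂ G)
      (LinearIsometryEquiv.ofEq _ _ (defectSpace_adjoint lam).symm)).trans
        (julia (adjoint lam) (by simpa using hlam)))

theorem rowUnitary_apply_fst (lam : G →L[ℂ] K) (hlam : ‖lam‖ ≤ 1) (g : codefectSpace lam) (y : G) :
    (rowUnitary lam hlam (hpair g y)).fst = codefect lam g + lam y := by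
  have h : (rowUnitary lam hlam (hpair g y)).fst =
      adjoint (adjoint lam) y + defect (adjoint lam) (g : K) := rfl
  rw [h, adjoint_adjoint, defect_adjoint, add_comm]

variable (C : Fin d → HC →L[ℂ] HC) (hC : IsRowContraction C)
  (T : Fin d → HA →L[ℂ] HA) (𝒱 : Colligation d HA X G)
  (lam : G →L[ℂ] defectSpace (rowOp C)) (hlam : ‖lam‖ ≤ 1)

/-- The colligation on `H_C ⊕ H_A` obtained by connecting the Julia colligation of `C` and a
colligation `𝒱` on `H_A` through `rowUnitary λ`. -/
def liftColligation : Colligation d (HSum HC HA) (HSum (codefectSpace lam) X)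
    (HSum (codefectSpace (rowOp C)) (codefectSpace (adjoint lam))) :=
  (juliaColligation C hC).cascade 𝒱 (rowUnitary lam hlam)

theorem liftColligation_apply_fst (c : HC) (a : HA) (g : codefectSpace lam) (x : X) :
    (liftColligation C hC 𝒱 lam hlam (hpair (hpair c a) (hpair g x))).fst =
      combine d HC HA (hpair (adjoint (rowOp C) c +
        defect (rowOp C) (codefect lam g + lam (𝒱 (hpair a x)).snd :)) (𝒱 (hpair a x)).fst) := by
  rw [liftColligation, Colligation.cascade_apply_fst, rowUnitary_apply_fst, juliaColligation,
    julia_apply_fst]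
  rfl

theorem adjoint_liftingRow_apply (φ : codefectSpace (rowOp T) ≃ₗᵢ[ℂ] G) (h : HA) :
    adjoint (codefectOn (rowOp T) ∘L φ.symm.toContinuousLinearEquiv.toContinuousLinearMap ∘L
      adjoint lam ∘L toDefect (rowOp C)) h =
        defect (rowOp C) (lam (φ (toCodefect (rowOp T) h))) := by
  have h1 : adjoint φ.symm.toContinuousLinearEquiv.toContinuousLinearMap =
      φ.toContinuousLinearEquiv.toContinuousLinearMap := by
    refine ContinuousLinearMap.ext fun y => ext_inner_right ℂ fun z => ?_
    have h2 := φ.inner_map_map y (φ.symm z)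
    rw [φ.apply_symm_apply] at h2
    rw [adjoint_inner_left]
    exact h2.symm
  rw [adjoint_comp, adjoint_comp, adjoint_comp, h1, adjoint_adjoint, comp_apply, comp_apply,
    comp_apply, adjoint_toDefect_apply, adjoint_codefectOn_apply]
  rfl

theorem adjoint_rowOp_liftE' (hT : ∀ s, adjoint (rowOp T) s = (𝒱 (hpair s 0)).fst)
    (φ : codefectSpace (rowOp T) ≃ₗᵢ[ℂ] G)
    (hφ : ∀ s, φ (toCodefect (rowOp T) s) = (𝒱 (hpair s 0)).snd) (u : HSum HC HA) :
    adjoint (rowOp (liftE' C T lam φ)) u =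
      (liftColligation C hC 𝒱 lam hlam (hpair u 0)).fst := by
  have h := liftColligation_apply_fst C hC 𝒱 lam hlam u.fst u.snd 0 0
  refine Eq.trans ?_ h.symm
  rw [liftE', adjoint_rowOp_lifting, adjoint_liftingRow_apply, hφ, hT]
  simp

theorem liftColligation_injective
    (hinj : ∀ x, (𝒱 (hpair 0 x)).fst = 0 → x = 0) (z : HSum (codefectSpace lam) X)
    (hz : (liftColligation C hC 𝒱 lam hlam (hpair 0 z)).fst = 0) : z = 0 := by
  have h := liftColligation_apply_fst C hC 𝒱 lam hlam 0 0 z.fst z.snd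
  have h0 : combine d HC HA _ = 0 := h.symm.trans hz
  rw [map_eq_zero_iff _ (combine d HC HA).injective] at h0
  have hx : z.snd = 0 := hinj _ (congrArg WithLp.snd h0)
  have hg : defect (rowOp C) (codefect lam z.fst : defectSpace (rowOp C)) = 0 := by
    have h1 := congrArg WithLp.fst h0
    rw [hx] at h1
    simpa [hpair_zero] using h1
  exact hsum_ext (eq_zero_of_codefect_eq_zero lam (eq_zero_of_defect_eq_zero _ hg)) hx

end LiftCorner

/-! ### The minimal isometric dilation -/

section FockAdjoint

variable {d : ℕ} {X : Type*} [NormedAddCommGroup X] [InnerProductSpace ℂ X] [CompleteSpace X]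

/-- `e_α ⊗ x`. -/
abbrev fockSingle (d : ℕ) (X : Type*) [NormedAddCommGroup X] [InnerProductSpace ℂ X]
    (α : List (Fin d)) : X →L[ℂ] Fock d X :=
  lp.singleContinuousLinearMap ℂ (fun _ : List (Fin d) => X) 2 α

theorem fockSingle_self (α : List (Fin d)) (x : X) : fockSingle d X α x α = x := by
  simp [fockSingle]

theorem fockSingle_ne {α β : List (Fin d)} (h : β ≠ α) (x : X) : fockSingle d X α x β = 0 := by
  simp [fockSingle, h]

theorem inner_fockSingle (f : Fock d X) (α : List (Fin d)) (x : X) :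
    inner ℂ f (fockSingle d X α x) = inner ℂ (f α) x :=
  lp.inner_single_right α x f

theorem norm_vac (x : X) : ‖vac d X x‖ = ‖x‖ := by
  rw [vac, lp.singleContinuousLinearMap_apply, lp.norm_single (by simp)]

theorem fock_ext_single {K : Type*} [NormedAddCommGroup K] [InnerProductSpace ℂ K]
    {P R : Fock d X →L[ℂ] K}
    (h : ∀ α x, P (fockSingle d X α x) = R (fockSingle d X α x)) (f : Fock d X) : P f = R f := by
  have : P = R := lp.ext_continuousLinearMap (by simp) fun α => ContinuousLinearMap.ext (h α)
  rw [this]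

theorem creation_fockSingle (j : Fin d) (α : List (Fin d)) (x : X) :
    creation X j (fockSingle d X α x) = fockSingle d X (j :: α) x := by
  refine lp.ext (funext fun β => ?_)
  cases β with
  | nil => rw [creation_nil, fockSingle_ne (by simp)]
  | cons k β =>
    rw [creation_cons]
    by_cases hk : k = j
    · subst hk
      by_cases hb : β = α
      · subst hb; rw [if_pos rfl, fockSingle_self, fockSingle_self]
      · rw [if_pos rfl, fockSingle_ne hb, fockSingle_ne (by simpa using hb)]
    · rw [if_neg hk, fockSingle_ne (by simp [hk])]

theorem adjoint_creation_apply (j : Fin d) (f : Fock d X) (β : List (Fin d)) :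
    adjoint (creation X j) f β = f (j :: β) := by
  refine ext_inner_right ℂ fun x => ?_
  rw [← inner_fockSingle, adjoint_inner_left, creation_fockSingle, inner_fockSingle]

theorem adjoint_creation_fockSingle_nil (j : Fin d) (x : X) :
    adjoint (creation X j) (fockSingle d X [] x) = 0 := by
  refine lp.ext (funext fun β => ?_)
  rw [adjoint_creation_apply, fockSingle_ne (by simp)]
  rfl

theorem adjoint_creation_creation (i j : Fin d) (f : Fock d X) :
    adjoint (creation X i) (creation X j f) = if i = j then f else 0 := by
  refine lp.ext (funext fun β => ?_)
  rw [adjoint_creation_apply, creation_cons]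
  split_ifs <;> rfl

theorem adjoint_vac_apply (f : Fock d X) : adjoint (vac d X) f = f [] := by
  refine ext_inner_right ℂ fun x => ?_
  rw [adjoint_inner_left]
  exact inner_fockSingle f [] x

end FockAdjoint

section Dilation

variable {d : ℕ} {H : Type*} [NormedAddCommGroup H] [InnerProductSpace ℂ H] [CompleteSpace H]

theorem dilation_apply (S : Fin d → H →L[ℂ] H) (j : Fin d) (z : DilSpace S) :
    dilation S j z = hpair (S j z.fst)
      (vac d _ (toDefect (rowOp S) (slot H j z.fst)) + creation _ j z.snd) := by
  rw [dilation, htri_apply]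
  rfl

theorem adjoint_dilation_apply (S : Fin d → H →L[ℂ] H) (j : Fin d) (z : DilSpace S) :
    adjoint (dilation S j) z = hpair (adjoint (S j) z.fst + defect (rowOp S) (z.snd []) j)
      (adjoint (creation _ j) z.snd) := by
  rw [dilation, adjoint_htri_apply, adjoint_comp, adjoint_comp, comp_apply, comp_apply,
    adjoint_vac_apply, adjoint_toDefect_apply, adjoint_slot_apply]

theorem slot_apply (i j : Fin d) (h : H) : slot H j h i = if i = j then h else 0 := by
  by_cases hij : i = j
  · subst hij; simp [slot]
  · simp [slot, hij]

theorem rowOp_slot (S : Fin d → H →L[ℂ] H) (j : Fin d) (h : H) : rowOp S (slot H j h) = S j h := by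
  rw [rowOp_apply, Finset.sum_eq_single j]
  · rw [slot_apply, if_pos rfl]
  · intro i _ hij; rw [slot_apply, if_neg hij, map_zero]
  · simp

/-- The operators `V^S_j` are isometries with orthogonal ranges. -/
theorem adjoint_dilation_dilation {S : Fin d → H →L[ℂ] H} (hS : IsRowContraction S) (i j : Fin d)
    (z : DilSpace S) :
    adjoint (dilation S i) (dilation S j z) = if i = j then z else 0 := by
  rw [adjoint_dilation_apply, dilation_apply]
  simp only [WithLp.toLp_fst, WithLp.toLp_snd, map_add]
  have h1 : (vac d _ (toDefect (rowOp S) (slot H j z.fst)) + creation _ j z.snd :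
      Fock d (defectSpace (rowOp S))) [] = toDefect (rowOp S) (slot H j z.fst) := by
    rw [lp.coeFn_add, Pi.add_apply, vac_nil, creation_nil, add_zero]
  have h2 : adjoint (creation _ i) (vac d _ (toDefect (rowOp S) (slot H j z.fst))) = 0 :=
    adjoint_creation_fockSingle_nil i _
  rw [h1, h2, coe_toDefect, defect_defect_apply hS.norm_rowOp_le, adjoint_creation_creation,
    zero_add, PiLp.sub_apply, adjoint_rowOp_apply, rowOp_slot, add_sub_cancel, slot_apply]
  split_ifs <;> rfl

theorem norm_dilation_apply {S : Fin d → H →L[ℂ] H} (hS : IsRowContraction S) (j : Fin d)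
    (z : DilSpace S) : ‖dilation S j z‖ = ‖z‖ := by
  have h : inner ℂ (dilation S j z) (dilation S j z) = inner ℂ z z := by
    rw [← adjoint_inner_left, adjoint_dilation_dilation hS, if_pos rfl]
  rw [inner_self_eq_norm_sq_to_K, inner_self_eq_norm_sq_to_K] at h
  exact (sq_eq_sq₀ (norm_nonneg _) (norm_nonneg _)).1 (by exact_mod_cast h)

end Dilation

/-! ### The characteristic function of a lifting -/

section Embedding

variable {d : ℕ} {HC HA : Type*}
  [NormedAddCommGroup HC] [InnerProductSpace ℂ HC] [CompleteSpace HC]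
  [NormedAddCommGroup HA] [InnerProductSpace ℂ HA] [CompleteSpace HA]

/-- An isometry `J` of the dilation space of `C` into that of `E` that is the identity on `H_C`,
intertwines the dilations, and whose range reduces the dilation of `E` yields the characteristic
function as `P_{Γ ⊗ 𝒟_C} J* |_{Γ ⊗ 𝒟_E}`: take `𝒦 = ker J*` and `W⁻¹ (a ⊕ k) = J a + k`. -/
theorem isLiftingCharFn_of_isometry (C : Fin d → HC →L[ℂ] HC)
    (E : Fin d → HSum HC HA →L[ℂ] HSum HC HA) (J : DilSpace C →ₗᵢ[ℂ] DilSpace E)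
    (hJ₀ : ∀ h : HC, J (hinl _ _ h) = hinl _ _ (hinl _ _ h))
    (hJ : ∀ i a, J (dilation C i a) = dilation E i (J a))
    (hJ' : ∀ i a, adjoint (dilation E i) (J a) = J (adjoint (dilation C i) a)) :
    IsLiftingCharFn C E
      (hsnd _ _ ∘L adjoint J.toContinuousLinearMap ∘L hinr _ _) := by
  set Js : DilSpace E →L[ℂ] DilSpace C := adjoint J.toContinuousLinearMap with hJs
  have hin : ∀ z a, inner ℂ (Js z) a = inner ℂ z (J a) := fun z a => by
    rw [hJs, adjoint_inner_left]; rfl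
  have hJsJ : ∀ a, Js (J a) = a := fun a => ext_inner_right ℂ fun b => by
    rw [hin, J.inner_map_map]
  have hJsV : ∀ i z, Js (dilation E i z) = dilation C i (Js z) := fun i z =>
    ext_inner_right ℂ fun b => by
      rw [hin, ← adjoint_inner_right, hJ', ← hin, adjoint_inner_right]
  let 𝒦 : Submodule ℂ (DilSpace E) := LinearMap.ker Js.toLinearMap
  have h𝒦 : ∀ k : 𝒦, Js k = 0 := fun k => k.2
  let Y : Fin d → 𝒦 →L[ℂ] 𝒦 := fun i =>
    (dilation E i ∘L 𝒦.subtypeL).codRestrict 𝒦 fun k => by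
      change Js (dilation E i k) = 0
      rw [hJsV, h𝒦, map_zero]
  have hsub : ∀ z, Js (z - J (Js z)) = 0 := fun z => by rw [map_sub, hJsJ, sub_self]
  let W' : HSum (DilSpace C) 𝒦 ≃ₗᵢ[ℂ] DilSpace E :=
    { toFun := fun v => J v.fst + v.snd
      invFun := fun z => hpair (Js z) ⟨z - J (Js z), hsub z⟩
      map_add' := fun u v => by
        change J (u.fst + v.fst) + ((u.snd : DilSpace E) + v.snd) = _
        rw [map_add, add_add_add_comm]
      map_smul' := fun c u => by
        change J (c • u.fst) + c • (u.snd : DilSpace E) = c • (J u.fst + u.snd)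
        rw [map_smul, smul_add]
      left_inv := fun v => by
        have h1 : Js (J v.fst + v.snd) = v.fst := by rw [map_add, hJsJ, h𝒦, add_zero]
        refine hsum_ext h1 (Subtype.ext ?_)
        change J v.fst + v.snd - J (Js (J v.fst + v.snd)) = v.snd
        rw [h1, add_sub_cancel_left]
      right_inv := fun z => by
        change J (Js z) + (z - J (Js z)) = z
        rw [add_sub_cancel]
      norm_map' := fun v => by
        have h0 : inner ℂ (J v.fst) (v.snd : DilSpace E) = 0 := by
          rw [← inner_conj_symm, ← hin, h𝒦, inner_zero_left, map_zero]
        refine (sq_eq_sq₀ (norm_nonneg _) (norm_nonneg _)).1 ?_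
        change ‖J v.fst + (v.snd : DilSpace E)‖ ^ 2 = _
        rw [@norm_add_sq ℂ, h0, J.norm_map, map_zero, mul_zero, add_zero, hsum_norm_sq v]
        rfl }
  have hW' : ∀ v, W' v = J v.fst + v.snd := fun _ => rfl
  refine ⟨𝒦, Y, W'.symm, fun h => ?_, fun i z => ?_, fun f => rfl⟩
  · rw [LinearIsometryEquiv.symm_apply_eq, hW']
    change _ = J (hinl _ _ h) + 0
    rw [hJ₀, add_zero]
  · rw [LinearIsometryEquiv.symm_apply_eq, hW', hdiag_apply]
    have hz : z = J (W'.symm z).fst + (W'.symm z).snd := by rw [← hW', W'.apply_symm_apply]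
    change _ = J (dilation C i (W'.symm z).fst) + dilation E i (W'.symm z).snd
    rw [hJ, ← map_add, ← hz]

variable (C : Fin d → HC →L[ℂ] HC) (B : Copies d HC →L[ℂ] HA) (A : Fin d → HA →L[ℂ] HA)

theorem rowOp_lifting (c : Copies d HC) (a : Copies d HA) :
    rowOp (lifting C B A) (combine d HC HA (hpair c a)) =
      hpair (rowOp C c) (B c + rowOp A a) := by
  refine ext_inner_left ℂ fun u => ?_
  rw [← adjoint_inner_left, adjoint_rowOp_lifting, LinearIsometryEquiv.inner_map_map, hsum_inner,
    hsum_inner]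
  simp only [WithLp.toLp_fst, WithLp.toLp_snd, inner_add_left, inner_add_right,
    adjoint_inner_left]
  ring

/-- The map `c ↦ (0 ⊕ B c) ⊕ e_∅ ⊗ D_E (c ⊕ 0)`, which sends `c` to the difference of
`∑ V^E_i c_i` and `∑ C_i c_i`. -/
def defectLift : Copies d HC →L[ℂ] DilSpace (lifting C B A) :=
  hinl _ _ ∘L hinr HC HA ∘L B +
    hinr _ _ ∘L vac d _ ∘L toDefect (rowOp (lifting C B A)) ∘L
      (combine d HC HA).toContinuousLinearEquiv.toContinuousLinearMap ∘L hinl _ _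

theorem defectLift_apply (c : Copies d HC) :
    defectLift C B A c = hpair (hpair 0 (B c))
      (vac d _ (toDefect (rowOp (lifting C B A)) (combine d HC HA (hpair c 0)))) := by
  refine hsum_ext ?_ ?_
  · exact add_zero _
  · exact zero_add _

variable {C B A}

theorem norm_defectLift (hC : IsRowContraction C) (hE : IsRowContraction (lifting C B A))
    (c : Copies d HC) :
    ‖defectLift C B A c‖ = ‖toDefect (rowOp C) c‖ := by
  refine (sq_eq_sq₀ (norm_nonneg _) (norm_nonneg _)).1 ?_
  rw [defectLift_apply, hsum_norm_sq, Submodule.coe_norm, coe_toDefect,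
    norm_sq_defect hC.norm_rowOp_le]
  simp only [WithLp.toLp_fst, WithLp.toLp_snd]
  rw [norm_vac, Submodule.coe_norm, coe_toDefect, norm_sq_defect hE.norm_rowOp_le, rowOp_lifting,
    LinearIsometryEquiv.norm_map, hsum_norm_sq, hsum_norm_sq, hsum_norm_sq]
  simp only [WithLp.toLp_fst, WithLp.toLp_snd, norm_zero, map_zero, add_zero]
  ring

end Embedding

section Wandering

variable {d : ℕ} {HC HA : Type*}
  [NormedAddCommGroup HC] [InnerProductSpace ℂ HC] [CompleteSpace HC]
  [NormedAddCommGroup HA] [InnerProductSpace ℂ HA] [CompleteSpace HA]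
  {C : Fin d → HC →L[ℂ] HC} {B : Copies d HC →L[ℂ] HA} {A : Fin d → HA →L[ℂ] HA}
  (Q : defectSpace (rowOp C) →ₗᵢ[ℂ] DilSpace (lifting C B A))

/-- `H_C` is invariant under the adjoints of the dilation of a lifting of `C`. -/
theorem adjoint_dilation_lifting_apply (i : Fin d) (h : HC) :
    adjoint (dilation (lifting C B A) i) (hpair (hpair h 0) 0) =
      hpair (hpair (adjoint (C i) h) 0) 0 := by
  rw [adjoint_dilation_apply]
  simp only [WithLp.toLp_fst, WithLp.toLp_snd, map_zero]
  rw [lifting, adjoint_htri_apply]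
  simp only [WithLp.toLp_fst, WithLp.toLp_snd, map_zero, add_zero, lp.coeFn_zero, Pi.zero_apply,
    Submodule.coe_zero, PiLp.zero_apply]

/-- The adjoints of the dilation of `E` map the image of `𝒟_C` back into `H_C`. -/
theorem adjoint_dilation_defectLift (hC : IsRowContraction C)
    (hE : IsRowContraction (lifting C B A))
    (hQ : ∀ c, Q (toDefect (rowOp C) c) = defectLift C B A c) (i : Fin d)
    (x : defectSpace (rowOp C)) :
    adjoint (dilation (lifting C B A) i) (Q x) = hpair (hpair (defect (rowOp C) x i) 0) 0 := by
  have hcont : Continuous fun x : defectSpace (rowOp C) =>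
      (hpair (hpair (defect (rowOp C) x i) 0) 0 : DilSpace (lifting C B A)) := by
    have h : Continuous fun x : defectSpace (rowOp C) =>
        hinl _ (Fock d (defectSpace (rowOp (lifting C B A)))) (hinl HC HA
          (PiLp.proj 2 (𝕜 := ℂ) (fun _ : Fin d => HC) i (defect (rowOp C) x))) := by
      fun_prop
    exact h
  refine (denseRange_toDefect (rowOp C)).induction_on
    (p := fun x => adjoint (dilation (lifting C B A) i) (Q x) =
      hpair (hpair (defect (rowOp C) x i) 0) 0) x (isClosed_eq (by fun_prop) hcont) fun c => ?_
  rw [hQ, defectLift_apply, adjoint_dilation_apply]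
  simp only [WithLp.toLp_fst, WithLp.toLp_snd]
  refine hsum_ext ?_ (adjoint_creation_fockSingle_nil i _)
  simp only [WithLp.toLp_fst, vac_nil, coe_toDefect]
  rw [defect_defect_apply hE.norm_rowOp_le, defect_defect_apply hC.norm_rowOp_le, rowOp_lifting,
    PiLp.sub_apply, PiLp.sub_apply, adjoint_rowOp_apply, adjoint_rowOp_apply, map_zero, add_zero,
    lifting, adjoint_htri_apply, adjoint_htri_apply]
  refine hsum_ext ?_ ?_
  · change adjoint (C i) 0 + _ + (c i - (adjoint (C i) (rowOp C c) + _)) =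
      c i - adjoint (C i) (rowOp C c)
    simp only [WithLp.toLp_snd, map_zero]
    abel
  · change adjoint (A i) (B c) + (0 - adjoint (A i) (B c)) = 0
    abel

/-- The isometry `V^E_α Q` of `𝒟_C` into the dilation space of `E`. -/
def wandering (hE : IsRowContraction (lifting C B A)) (α : List (Fin d)) :
    defectSpace (rowOp C) →ₗᵢ[ℂ] DilSpace (lifting C B A) where
  toLinearMap := (wordOp (dilation (lifting C B A)) α).toLinearMap ∘ₗ Q.toLinearMap
  norm_map' x := by
    change ‖wordOp (dilation (lifting C B A)) α (Q x)‖ = ‖x‖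
    rw [← Q.norm_map]
    generalize Q x = z
    induction α with
    | nil => rfl
    | cons k α ih =>
      refine Eq.trans ?_ ih
      exact norm_dilation_apply hE k (wordOp (dilation (lifting C B A)) α z)

theorem wandering_nil (hE : IsRowContraction (lifting C B A)) (x : defectSpace (rowOp C)) :
    wandering Q hE [] x = Q x := rfl

theorem wandering_cons (hE : IsRowContraction (lifting C B A)) (k : Fin d) (α : List (Fin d))
    (x : defectSpace (rowOp C)) :
    wandering Q hE (k :: α) x = dilation (lifting C B A) k (wandering Q hE α x) := rfl

theorem inner_wandering_eq_zero (hE : IsRowContraction (lifting C B A))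
    (hQ : ∀ c, Q (toDefect (rowOp C) c) = defectLift C B A c)
    (α : List (Fin d)) (h : HC) (x : defectSpace (rowOp C)) :
    inner ℂ (hpair (hpair h 0) 0 : DilSpace (lifting C B A)) (wandering Q hE α x) = 0 := by
  induction α generalizing h with
  | nil =>
    rw [wandering_nil]
    refine (denseRange_toDefect (rowOp C)).induction_on
      (p := fun x => inner ℂ (hpair (hpair h 0) 0 : DilSpace (lifting C B A)) (Q x) = 0) x
      (isClosed_eq (by fun_prop) continuous_const) fun c => ?_
    rw [hQ, defectLift_apply, hsum_inner, hsum_inner]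
    simp
  | cons k α ih =>
    rw [wandering_cons, ← adjoint_inner_left, adjoint_dilation_lifting_apply, ih]

/-- The range of `Q` is a wandering subspace: its images under the words in `V^E_1, …, V^E_d` are
mutually orthogonal. -/
theorem orthogonalFamily_wandering (hC : IsRowContraction C)
    (hE : IsRowContraction (lifting C B A))
    (hQ : ∀ c, Q (toDefect (rowOp C) c) = defectLift C B A c) :
    OrthogonalFamily ℂ (fun _ : List (Fin d) => defectSpace (rowOp C)) (wandering Q hE) := by
  have h0 : ∀ (k : Fin d) (β : List (Fin d)) (x y : defectSpace (rowOp C)),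
      inner ℂ (wandering Q hE [] x) (wandering Q hE (k :: β) y) = 0 := fun k β x y => by
    rw [wandering_nil, wandering_cons, ← adjoint_inner_left,
      adjoint_dilation_defectLift Q hC hE hQ, inner_wandering_eq_zero Q hE hQ]
  intro α β hne x y
  induction α generalizing β with
  | nil =>
    cases β with
    | nil => exact absurd rfl hne
    | cons k β => exact h0 k β x y
  | cons j α ih =>
    cases β with
    | nil => rw [← inner_conj_symm, h0, map_zero]
    | cons k β =>
      rw [wandering_cons, wandering_cons, ← adjoint_inner_left, adjoint_dilation_dilation hE]
      by_cases hkj : k = j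
      · subst hkj
        rw [if_pos rfl]
        exact ih fun h => hne (by rw [h])
      · rw [if_neg hkj, inner_zero_left]

variable (R : Fock d (defectSpace (rowOp C)) →ₗᵢ[ℂ] DilSpace (lifting C B A))

theorem inner_wanderingSum_eq_zero (hE : IsRowContraction (lifting C B A))
    (hQ : ∀ c, Q (toDefect (rowOp C) c) = defectLift C B A c)
    (hR : ∀ α x, R (fockSingle d _ α x) = wandering Q hE α x) (h : HC)
    (f : Fock d (defectSpace (rowOp C))) :
    inner ℂ (hpair (hpair h 0) 0 : DilSpace (lifting C B A)) (R f) = 0 :=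
  fock_ext_single (P := innerSL ℂ (hpair (hpair h 0) 0 : DilSpace (lifting C B A)) ∘L
    R.toContinuousLinearMap) (R := 0) (fun α x => by
      refine Eq.trans ?_ (inner_wandering_eq_zero Q hE hQ α h x)
      rw [← hR]
      rfl) f

theorem wanderingSum_creation (hE : IsRowContraction (lifting C B A))
    (hR : ∀ α x, R (fockSingle d _ α x) = wandering Q hE α x) (i : Fin d)
    (f : Fock d (defectSpace (rowOp C))) :
    R (creation _ i f) = dilation (lifting C B A) i (R f) :=
  fock_ext_single (P := R.toContinuousLinearMap ∘L creation _ i)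
    (R := dilation (lifting C B A) i ∘L R.toContinuousLinearMap) (fun α x => by
      change R (creation _ i (fockSingle d _ α x)) =
        dilation (lifting C B A) i (R (fockSingle d _ α x))
      rw [creation_fockSingle, hR, hR, wandering_cons]) f

theorem adjoint_dilation_wanderingSum (hC : IsRowContraction C)
    (hE : IsRowContraction (lifting C B A))
    (hQ : ∀ c, Q (toDefect (rowOp C) c) = defectLift C B A c)
    (hR : ∀ α x, R (fockSingle d _ α x) = wandering Q hE α x) (i : Fin d)
    (f : Fock d (defectSpace (rowOp C))) :
    adjoint (dilation (lifting C B A) i) (R f) =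
      hpair (hpair (defect (rowOp C) (f []) i) 0) 0 + R (adjoint (creation _ i) f) := by
  -- The entry `f []` is written as `adjoint (vac d _) f` to make both sides operators in `f`.
  have key := fock_ext_single
    (P := adjoint (dilation (lifting C B A) i) ∘L R.toContinuousLinearMap)
    (R := hinl _ _ ∘L hinl _ _ ∘L adjoint (slot HC i) ∘L
      adjoint (toDefect (rowOp C)) ∘L adjoint (vac d _) +
        R.toContinuousLinearMap ∘L adjoint (creation _ i)) (fun α x => ?_) f
  · simp only [add_apply, comp_apply, adjoint_vac_apply, adjoint_toDefect_apply,
      adjoint_slot_apply, hinl_apply] at key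
    exact key
  · simp only [add_apply, comp_apply, adjoint_vac_apply, adjoint_toDefect_apply,
      adjoint_slot_apply, hinl_apply]
    change adjoint (dilation (lifting C B A) i) (R (fockSingle d _ α x)) = _ +
      R (adjoint (creation _ i) (fockSingle d _ α x))
    rw [hR]
    cases α with
    | nil =>
      rw [fockSingle_self, wandering_nil, adjoint_creation_fockSingle_nil, map_zero, add_zero,
        adjoint_dilation_defectLift Q hC hE hQ]
    | cons k α =>
      rw [fockSingle_ne (by simp), wandering_cons, adjoint_dilation_dilation hE,
        ← creation_fockSingle, adjoint_creation_creation]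
      simp only [Submodule.coe_zero, map_zero, PiLp.zero_apply, hpair_zero, zero_add]
      split_ifs
      · rw [hR]
      · rw [map_zero]

theorem adjoint_wanderingSum_apply (hE : IsRowContraction (lifting C B A))
    (hR : ∀ α x, R (fockSingle d _ α x) = wandering Q hE α x)
    (z : DilSpace (lifting C B A)) (α : List (Fin d)) :
    adjoint R.toContinuousLinearMap z α = adjoint Q.toContinuousLinearMap
      (adjoint (wordOp (dilation (lifting C B A)) α) z) := by
  refine ext_inner_right ℂ fun x => ?_
  rw [← inner_fockSingle, adjoint_inner_left, adjoint_inner_left, adjoint_inner_left]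
  change inner ℂ z (R (fockSingle d _ α x)) = _
  rw [hR]
  rfl

theorem hsum_inner_hpair_zero {X Y : Type*} [NormedAddCommGroup X] [InnerProductSpace ℂ X]
    [NormedAddCommGroup Y] [InnerProductSpace ℂ Y] (w : HSum X Y) (y : Y) :
    inner ℂ w (hpair 0 y) = inner ℂ w.snd y := by
  rw [hsum_inner]
  simp

/-- The embedding `h ⊕ f ↦ h + R f` of the dilation space of `C` into that of the lifting `E`. -/
def dilationEmbedding (R : Fock d (defectSpace (rowOp C)) →ₗᵢ[ℂ] DilSpace (lifting C B A))
    (hR : ∀ (h : HC) f,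
      inner ℂ (hpair (hpair h 0) 0 : DilSpace (lifting C B A)) (R f) = 0) :
    DilSpace C →ₗᵢ[ℂ] DilSpace (lifting C B A) where
  toLinearMap := (hinl _ _ ∘L hinl _ _ ∘L hfst _ _ +
    R.toContinuousLinearMap ∘L hsnd _ _ : DilSpace C →L[ℂ] _).toLinearMap
  norm_map' a := by
    refine (sq_eq_sq₀ (norm_nonneg _) (norm_nonneg _)).1 ?_
    change ‖(hpair (hpair a.fst 0) 0 : DilSpace (lifting C B A)) + R a.snd‖ ^ 2 = _
    rw [@norm_add_sq ℂ, hR, R.norm_map, map_zero, mul_zero, add_zero, hsum_norm_sq,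
      hsum_norm_sq, hsum_norm_sq a]
    simp

theorem dilationEmbedding_apply
    (hR : ∀ (h : HC) f,
      inner ℂ (hpair (hpair h 0) 0 : DilSpace (lifting C B A)) (R f) = 0) (a : DilSpace C) :
    dilationEmbedding R hR a = hpair (hpair a.fst 0) 0 + R a.snd := rfl

theorem combine_slot (i : Fin d) (h : HC) :
    combine d HC HA (hpair (slot HC i h) 0) = slot (HSum HC HA) i (hpair h 0) := by
  ext1 k
  rw [slot_apply]
  change hpair (slot HC i h k) 0 = _
  rw [slot_apply]
  split_ifs <;> rfl

theorem dilationEmbedding_dilation (hE : IsRowContraction (lifting C B A))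
    (hQ : ∀ c, Q (toDefect (rowOp C) c) = defectLift C B A c)
    (hR : ∀ α x, R (fockSingle d _ α x) = wandering Q hE α x)
    (hR₀ : ∀ (h : HC) f,
      inner ℂ (hpair (hpair h 0) 0 : DilSpace (lifting C B A)) (R f) = 0)
    (i : Fin d) (a : DilSpace C) :
    dilationEmbedding R hR₀ (dilation C i a) =
      dilation (lifting C B A) i (dilationEmbedding R hR₀ a) := by
  rw [dilationEmbedding_apply, dilationEmbedding_apply, map_add,
    ← wanderingSum_creation Q R hE hR, dilation_apply, dilation_apply]
  simp only [WithLp.toLp_fst, WithLp.toLp_snd, map_add, map_zero, add_zero]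
  have h1 : R (vac d _ (toDefect (rowOp C) (slot HC i a.fst))) =
      defectLift C B A (slot HC i a.fst) := by
    rw [← hQ]
    exact hR [] _
  have h3 : lifting C B A i (hpair a.fst 0) = hpair (C i a.fst) (B (slot HC i a.fst)) := by
    rw [lifting, htri_apply]
    simp
  rw [h1, defectLift_apply, combine_slot, h3, ← add_assoc]
  congr 1
  rw [← hpair_add, ← hpair_add, add_zero, zero_add, zero_add]

theorem adjoint_dilation_dilationEmbedding (hC : IsRowContraction C)
    (hE : IsRowContraction (lifting C B A))
    (hQ : ∀ c, Q (toDefect (rowOp C) c) = defectLift C B A c)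
    (hR : ∀ α x, R (fockSingle d _ α x) = wandering Q hE α x)
    (hR₀ : ∀ (h : HC) f,
      inner ℂ (hpair (hpair h 0) 0 : DilSpace (lifting C B A)) (R f) = 0)
    (i : Fin d) (a : DilSpace C) :
    adjoint (dilation (lifting C B A) i) (dilationEmbedding R hR₀ a) =
      dilationEmbedding R hR₀ (adjoint (dilation C i) a) := by
  rw [dilationEmbedding_apply, dilationEmbedding_apply, map_add,
    adjoint_dilation_wanderingSum Q R hC hE hQ hR, adjoint_dilation_lifting_apply,
    adjoint_dilation_apply, ← add_assoc]
  simp only [WithLp.toLp_fst, WithLp.toLp_snd]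
  congr 1
  rw [← hpair_add, ← hpair_add, add_zero, add_zero]

/-- The characteristic function of a lifting `E = [[C, 0], [B, A]]` is `f ↦ (Q* (V^E_α)* f)_α`, where
`Q` is the isometry of `𝒟_C` with `Q D_C c = (0 ⊕ B c) ⊕ e_∅ ⊗ D_E (c ⊕ 0)`. -/
theorem exists_isLiftingCharFn (hC : IsRowContraction C) (hE : IsRowContraction (lifting C B A)) :
    ∃ Q : defectSpace (rowOp C) →ₗᵢ[ℂ] DilSpace (lifting C B A),
      (∀ c, Q (toDefect (rowOp C) c) = defectLift C B A c) ∧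
      ∃ M, IsLiftingCharFn C (lifting C B A) M ∧
        ∀ f β, M f β = adjoint Q.toContinuousLinearMap
          (adjoint (wordOp (dilation (lifting C B A)) β) (hpair 0 f)) := by
  obtain ⟨Q, hQ⟩ := exists_isometry_of_norm_eq (toDefect (rowOp C)) (defectLift C B A)
    (denseRange_toDefect _) (norm_defectLift hC hE)
  obtain ⟨R, hR⟩ : ∃ R : Fock d (defectSpace (rowOp C)) →ₗᵢ[ℂ] DilSpace (lifting C B A),
      ∀ α x, R (fockSingle d _ α x) = wandering Q hE α x :=
    ⟨(orthogonalFamily_wandering Q hC hE hQ).linearIsometry, fun α x =>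
      (orthogonalFamily_wandering Q hC hE hQ).linearIsometry_apply_single x⟩
  have hR₀ := inner_wanderingSum_eq_zero Q R hE hQ hR
  refine ⟨Q, hQ, _, isLiftingCharFn_of_isometry C (lifting C B A) (dilationEmbedding R hR₀)
    (fun h => ?_) (dilationEmbedding_dilation Q R hE hQ hR hR₀)
    (adjoint_dilation_dilationEmbedding Q R hC hE hQ hR hR₀), fun f β => ?_⟩
  · rw [dilationEmbedding_apply]
    change _ + R 0 = _
    rw [map_zero, add_zero]
    rfl
  · rw [← adjoint_wanderingSum_apply Q R hE hR]
    have h1 : hsnd _ _ (adjoint (dilationEmbedding R hR₀).toContinuousLinearMap (hpair 0 f)) =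
        adjoint R.toContinuousLinearMap (hpair 0 f) := by
      refine ext_inner_right ℂ fun g => ?_
      rw [hsnd_apply, ← hsum_inner_hpair_zero, adjoint_inner_left, adjoint_inner_left]
      change inner ℂ _ (dilationEmbedding R hR₀ (hpair 0 g)) = inner ℂ _ (R g)
      rw [dilationEmbedding_apply]
      change inner ℂ _ (0 + R g) = _
      rw [zero_add]
    exact congrArg (fun g : Fock d (defectSpace (rowOp C)) => g β) h1

end Wandering

/-! ### The characteristic function of the lifting `E'` -/

section ThreeBlocks

variable {d : ℕ} {X Y X' Y' F Fs G Z : Type*}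
  [NormedAddCommGroup X] [InnerProductSpace ℂ X]
  [NormedAddCommGroup Y] [InnerProductSpace ℂ Y]
  [NormedAddCommGroup X'] [InnerProductSpace ℂ X']
  [NormedAddCommGroup Y'] [InnerProductSpace ℂ Y']
  [NormedAddCommGroup F] [InnerProductSpace ℂ F]
  [NormedAddCommGroup Fs] [InnerProductSpace ℂ Fs]
  [NormedAddCommGroup G] [InnerProductSpace ℂ G]
  [NormedAddCommGroup Z] [InnerProductSpace ℂ Z]

theorem ampl_hfst_fockDiag (M : Fock d X →L[ℂ] Fock d X') (N : Fock d Y →L[ℂ] Fock d Y')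
    (f : Fock d (HSum X Y)) :
    ampl d (hfst X' Y') (fockDiag M N f) = M (ampl d (hfst X Y) f) := by
  refine lp.ext (funext fun β => ?_)
  rw [ampl_apply, fockDiag_apply]
  rfl

theorem ampl_hsnd_fockDiag (M : Fock d X →L[ℂ] Fock d X') (N : Fock d Y →L[ℂ] Fock d Y')
    (f : Fock d (HSum X Y)) :
    ampl d (hsnd X' Y') (fockDiag M N f) = N (ampl d (hsnd X Y) f) := by
  refine lp.ext (funext fun β => ?_)
  rw [ampl_apply, fockDiag_apply]
  rfl

theorem threeBlockProduct_apply (D : Z →L[ℂ] G) (lam : HSum Y Fs →L[ℂ] G)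
    (M : Fock d X →L[ℂ] Fock d Y) (M' : Fock d X' →L[ℂ] Fock d Y')
    (U : HSum F Y' ≃ₗᵢ[ℂ] HSum X Fs) (f : Fock d (HSum Z (HSum F X'))) (β : List (Fin d)) :
    threeBlockProduct D lam M M' U f β =
      D (f β).fst + lam (twoBlockProduct M M' U (ampl d (hsnd Z (HSum F X')) f) β) := by
  rw [threeBlockProduct, comp_apply, comp_apply, comp_apply, ampl_apply, fockDiag_apply,
    ampl_hfst_fockDiag, ampl_hfst_fockDiag, ampl_hsnd_fockDiag, ampl_hsnd_fockDiag]
  rfl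

end ThreeBlocks

section LiftOutput

variable {d : ℕ} {HC HA X G Z : Type*}
  [NormedAddCommGroup HC] [InnerProductSpace ℂ HC] [CompleteSpace HC]
  [NormedAddCommGroup HA] [InnerProductSpace ℂ HA] [CompleteSpace HA]
  [NormedAddCommGroup X] [InnerProductSpace ℂ X] [CompleteSpace X]
  [NormedAddCommGroup G] [InnerProductSpace ℂ G] [CompleteSpace G]
  [NormedAddCommGroup Z] [InnerProductSpace ℂ Z]
  {C : Fin d → HC →L[ℂ] HC}
  {B : Copies d HC →L[ℂ] HA} {T : Fin d → HA →L[ℂ] HA} (𝒱 : Colligation d HA X G)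
  (lam : G →L[ℂ] defectSpace (rowOp C))
  (𝒲 : Colligation d (HSum HC HA) (HSum (codefectSpace lam) X) Z)
  (Q : defectSpace (rowOp C) →ₗᵢ[ℂ] DilSpace (lifting C B T))
  (τ : HSum (codefectSpace lam) X → defectSpace (rowOp (lifting C B T)))

/-- `Q*` reads off the output of the colligation of the lifting in `𝒟_C` before it enters the Julia
colligation of `C`. -/
theorem adjoint_defectLift_output
    (h𝒲 : ∀ c a g x, (𝒲 (hpair (hpair c a) (hpair g x))).fst =
      combine d HC HA (hpair (adjoint (rowOp C) c +
        defect (rowOp C) (codefect lam g + lam (𝒱 (hpair a x)).snd :)) (𝒱 (hpair a x)).fst))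
    (hB : ∀ h, adjoint B h = defect (rowOp C) (lam (𝒱 (hpair h 0)).snd))
    (hQ : ∀ c, Q (toDefect (rowOp C) c) = defectLift C B T c)
    (hτ : ∀ z, defect (rowOp (lifting C B T)) (τ z) =
      (𝒲 (hpair 0 z)).fst)
    (c : HC) (h : HA) (f : Fock d (defectSpace (rowOp (lifting C B T))))
    (z : HSum (codefectSpace lam) X) (hf : f [] = τ z) :
    adjoint Q.toContinuousLinearMap (hpair (hpair c h) f) =
      codefect lam z.fst + lam (𝒱 (hpair h z.snd)).snd := by
  refine (denseRange_toDefect (rowOp C)).eq_of_inner_left ℂ fun y => ?_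
  have h2 : inner ℂ (f []) (toDefect (rowOp (lifting C B T)) (combine d HC HA (hpair y 0))) =
      inner ℂ (defect (rowOp C) (codefect lam z.fst + lam (𝒱 (hpair 0 z.snd)).snd :)) y := by
    have h3 := h𝒲 0 0 z.fst z.snd
    rw [← adjoint_toDefect_apply, ← adjoint_inner_left, adjoint_toDefect_apply,
      adjoint_toDefect_apply, hf, hτ]
    refine (congrArg (fun w => inner ℂ w (combine d HC HA (hpair y 0))) h3).trans ?_
    rw [LinearIsometryEquiv.inner_map_map, hsum_inner]
    simp
  rw [adjoint_inner_left]
  change inner ℂ (hpair (hpair c h) f) (Q (toDefect (rowOp C) y)) = _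
  rw [hQ, defectLift_apply, hsum_inner, hsum_inner]
  simp only [WithLp.toLp_fst, WithLp.toLp_snd, inner_zero_right, zero_add]
  rw [← adjoint_inner_left B, hB]
  refine (congrArg (_ + ·) ((inner_fockSingle f [] _).trans h2)).trans ?_
  rw [← inner_add_left, ← adjoint_inner_left (toDefect (rowOp C)), adjoint_toDefect_apply,
    𝒱.apply_snd_eq_add h z.snd, ← map_add, ← Submodule.coe_add, map_add lam, add_left_comm]

/-- Through the identification `τ` of the input spaces, the family `(Q* (V^E_β)* ·)_β` is the output
family of the colligation of the lifting. -/
theorem adjoint_wordOp_dilation_output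
    (h𝒲 : ∀ c a g x, (𝒲 (hpair (hpair c a) (hpair g x))).fst =
      combine d HC HA (hpair (adjoint (rowOp C) c +
        defect (rowOp C) (codefect lam g + lam (𝒱 (hpair a x)).snd :)) (𝒱 (hpair a x)).fst))
    (hB : ∀ h, adjoint B h = defect (rowOp C) (lam (𝒱 (hpair h 0)).snd))
    (hQ : ∀ c, Q (toDefect (rowOp C) c) = defectLift C B T c)
    (hτ : ∀ z, defect (rowOp (lifting C B T)) (τ z) =
      (𝒲 (hpair 0 z)).fst)
    (hE : ∀ u, adjoint (rowOp (lifting C B T)) u =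
      (𝒲 (hpair u 0)).fst)
    (β : List (Fin d)) (c : HC) (h : HA) (f : Fock d (defectSpace (rowOp (lifting C B T))))
    (g : List (Fin d) → HSum (codefectSpace lam) X) (hf : ∀ α, f α = τ (g α)) :
    adjoint Q.toContinuousLinearMap
        (adjoint (wordOp (dilation (lifting C B T)) β) (hpair (hpair c h) f)) =
      codefect lam (g β).fst + lam (output 𝒱 β h fun α => (g α).snd) := by
  induction β generalizing c h f g with
  | nil =>
    rw [adjoint_wordOp_nil_apply]
    exact adjoint_defectLift_output 𝒱 lam 𝒲 Q τ h𝒲 hB hQ hτ c h f (g []) (hf [])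
  | cons k β ih =>
    have h1 : adjoint (lifting C B T k) (hpair c h) +
        defect (rowOp (lifting C B T)) (f []) k =
          (𝒲 (hpair (hpair c h) (g []))).fst k := by
      rw [← adjoint_rowOp_apply, hE, hf, hτ,
        Colligation.apply_fst_eq_add _ (hpair c h) (g []), PiLp.add_apply]
    rw [adjoint_wordOp_cons_apply, adjoint_dilation_apply, output]
    simp only [WithLp.toLp_fst, WithLp.toLp_snd]
    rw [h1, show 𝒲 (hpair (hpair c h) (g [])) = 𝒲 (hpair (hpair c h) (hpair (g []).fst (g []).snd)) from rfl,
      h𝒲]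
    exact ih _ _ _ (fun α => g (k :: α)) fun α => by rw [adjoint_creation_apply, hf]

/-- If `T*` is the state operator of a unitary colligation `𝒱` with input-output map `N`, and `𝒱`
sends no nonzero input to the output alone, then for a suitable `φ` the lifting of `C` by `T` and
`λ` has, up to a unitary `τ` of the input space, the characteristic function
`[I ⊗ D_{*,λ}  I ⊗ λ] diag(I, N)`. -/
theorem exists_liftE'_charFn (hC : IsRowContraction C) (hlam : ‖lam‖ ≤ 1)
    (hT : ∀ s, adjoint (rowOp T) s = (𝒱 (hpair s 0)).fst)
    (hinj : ∀ x, (𝒱 (hpair 0 x)).fst = 0 → x = 0) :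
    ∃ φ : codefectSpace (rowOp T) ≃ₗᵢ[ℂ] G,
      IsRowContraction (liftE' C T lam φ) ∧
      ∃ M : Fock d (defectSpace (rowOp (liftE' C T lam φ))) →L[ℂ] Fock d (defectSpace (rowOp C)),
        IsLiftingCharFn C (liftE' C T lam φ) M ∧
        ∃ τ : HSum (codefectSpace lam) X ≃ₗᵢ[ℂ] defectSpace (rowOp (liftE' C T lam φ)),
          ∀ (f : Fock d (HSum (codefectSpace lam) X)) (β : List (Fin d)),
            M (ampl d τ.toContinuousLinearEquiv.toContinuousLinearMap f) β =
              codefectOn lam (f β).fst + lam (output 𝒱 β 0 fun α => (f α).snd) := by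
  obtain ⟨φ, hφ⟩ := exists_codefect_unitary 𝒱 (rowOp T) hT hinj
  obtain ⟨𝒲, h𝒲, h𝒲inj, hE⟩ :
      ∃ 𝒲 : Colligation d (HSum HC HA) (HSum (codefectSpace lam) X)
          (HSum (codefectSpace (rowOp C)) (codefectSpace (adjoint lam))),
        (∀ c a g x, (𝒲 (hpair (hpair c a) (hpair g x))).fst =
          combine d HC HA (hpair (adjoint (rowOp C) c +
            defect (rowOp C) (codefect lam g + lam (𝒱 (hpair a x)).snd :))
              (𝒱 (hpair a x)).fst)) ∧
        (∀ z, (𝒲 (hpair 0 z)).fst = 0 → z = 0) ∧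
        ∀ u, adjoint (rowOp (liftE' C T lam φ)) u = (𝒲 (hpair u 0)).fst :=
    ⟨liftColligation C hC 𝒱 lam hlam, liftColligation_apply_fst C hC 𝒱 lam hlam,
      liftColligation_injective C hC 𝒱 lam hlam hinj,
      adjoint_rowOp_liftE' C hC T 𝒱 lam hlam hT φ hφ⟩
  have hErow : IsRowContraction (liftE' C T lam φ) :=
    isRowContraction_of_norm_le (norm_le_one_of_corner 𝒲 _ hE)
  obtain ⟨τ, hτ⟩ := exists_defect_unitary 𝒲 (rowOp (liftE' C T lam φ)) hE h𝒲inj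
  obtain ⟨Q, hQ, M, hMchar, hMQ⟩ := exists_isLiftingCharFn hC hErow
  refine ⟨φ, hErow, M, hMchar, τ, fun f β => ?_⟩
  refine (hMQ _ β).trans ?_
  refine adjoint_wordOp_dilation_output 𝒱 lam 𝒲 Q τ h𝒲 (fun h => ?_) hQ hτ hE β 0 0 _ f
    fun α => rfl
  rw [← hφ]
  exact adjoint_liftingRow_apply C T lam φ h

end LiftOutput

end

theorem mainTheorem2 {d : ℕ} {HC HA HA' F Fs : Type*}
    [NormedAddCommGroup HC] [InnerProductSpace ℂ HC] [CompleteSpace HC]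
    [NormedAddCommGroup HA] [InnerProductSpace ℂ HA] [CompleteSpace HA]
    [NormedAddCommGroup HA'] [InnerProductSpace ℂ HA'] [CompleteSpace HA']
    [NormedAddCommGroup F] [InnerProductSpace ℂ F] [CompleteSpace F]
    [NormedAddCommGroup Fs] [InnerProductSpace ℂ Fs] [CompleteSpace Fs]
    (C : Fin d → HC →L[ℂ] HC) (hC : IsRowContraction C)
    (A : Fin d → HA →L[ℂ] HA) (hA : IsRowContraction A)
    (A' : Fin d → HA' →L[ℂ] HA') (hA' : IsRowContraction A')
    (lam : HSum (codefectSpace (rowOp A)) Fs →L[ℂ] defectSpace (rowOp C)) (hlam : ‖lam‖ ≤ 1)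
    (U : HSum F (codefectSpace (rowOp A')) ≃ₗᵢ[ℂ] HSum (defectSpace (rowOp A)) Fs)
    (hM : IsPurelyContractive (X := HSum F (defectSpace (rowOp A')))
      (Y := HSum (codefectSpace (rowOp A)) Fs)
      (twoBlockProduct (charFn A hA) (charFn A' hA') U)) :
    IsRowContraction (hatA A A' U) ∧
    ∃ φ : codefectSpace (rowOp (hatA A A' U)) ≃ₗᵢ[ℂ] HSum (codefectSpace (rowOp A)) Fs,
      IsRowContraction (liftE' C (hatA A A' U) lam φ) ∧
      ∃ M : Fock d (defectSpace (rowOp (liftE' C (hatA A A' U) lam φ))) →L[ℂ]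
          Fock d (defectSpace (rowOp C)),
        IsLiftingCharFn C (liftE' C (hatA A A' U) lam φ) M ∧
        ∃ τ : HSum (codefectSpace lam) (HSum F (defectSpace (rowOp A'))) ≃ₗᵢ[ℂ]
            defectSpace (rowOp (liftE' C (hatA A A' U) lam φ)),
          M ∘L ampl d τ.toContinuousLinearEquiv.toContinuousLinearMap =
            threeBlockProduct (codefectOn lam) lam (charFn A hA) (charFn A' hA') U := by
  have hT := adjoint_rowOp_hatA A hA A' hA' U
  have hinj := hatColligation_injective A hA A' hA' U hM
  refine ⟨isRowContraction_of_norm_le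
    (norm_le_one_of_corner (hatColligation A hA A' hA' U) _ hT), ?_⟩
  obtain ⟨φ, hE, M, hMchar, τ, hτ⟩ :=
    exists_liftE'_charFn (hatColligation A hA A' hA' U) lam hC hlam hT hinj
  refine ⟨φ, hE, M, hMchar, τ, ContinuousLinearMap.ext fun f => lp.ext (funext fun β => ?_)⟩
  rw [threeBlockProduct_apply, twoBlockProduct_apply, comp_apply, hτ]
  rfl
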